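/- Let $k$ be a finite Galois extension of $\mathbb Q$ of degree $d$ with ring of integers $\mathcal O$, let $K$ be an algebraically closed field containing $k$, and let $H\le \mathrm{GL}_n(K)$ be a linear algebraic group defined over $k$, given as the zero locus in $\mathrm{GL}_n(K)$ of finitely many polynomials $P_1,\dots,P_l$ over $k$ in the matrix entries. Fix a basis of $k$ over $\mathbb Q$, let $\rho\colon k\to M_d(\mathbb Q)$ be the regular representation with respect to it, and write $\rho$ also for the induced map $M_n(k)\to M_{nd}(\mathbb Q)$. Let $G=\mathcal R_{k/\mathbb Q}H\le \mathrm{GL}_{nd}(K)$ be the restriction of scalars: the group of all invertible $n\times n$ block matrices over $K$ whose $d\times d$ blocks lie in the $K$-span of $\rho(k)\cong K\otimes_{\mathbb Q}k$ and satisfy the defining equations of $H$ (coefficients in $k$ acting through $\rho$). Let $Q_1,\dots,Q_m$ be any finite system of polynomials over $\mathbb Q$ with zero locus $G$ in $\mathrm{GL}_{nd}(K)$. For a rational prime $p$ let $G_{\mathbb F_p}\subseteq \mathrm{GL}_{nd}(\mathbb F_p)$ be the set of zeros of the reductions of the $Q_i$ modulo $p$, and for a prime ideal $\mathfrak p$ of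 $\mathcal O$ with $q(\mathfrak p)=|\mathcal O/\mathfrak p|$ let $H_{\mathbb F_{q(\mathfrak p)}}\subseteq \mathrm{GL}_n(\mathcal O/\mathfrak p)$ be the set of zeros of the reductions of the $P_j$ modulo $\mathfrak p$ (these are meaningful for all but finitely many primes). Then for all but finitely many primes $p$ the sets $G_{\mathbb F_p}$ and $H_{\mathbb F_{q(\mathfrak p)}}$, $\mathfrak p\mid p$, are subgroups, and $$G_{\mathbb F_p}\;\cong\;\prod_{\mathfrak p\mid p}H_{\mathbb F_{q(\mathfrak p)}}$$ as groups, the product being over all prime ideals $\mathfrak p$ of $\mathcal O$ dividing $p$. More precisely there is an isomorphism $\Phi$ such that for all $g\in G_{\mathbb F_p}$ and $A\in M_n(\mathcal O)$ one has $\Phi(g)_{\mathfrak p}=A \bmod \mathfrak p$ for all $\mathfrak p\mid p$ if and only if $\rho(A)$ has $p$-integral entries and $\rho(A)\bmod p=g$. -/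

import Mathlib

open scoped TensorProduct MatrixGroups NumberField

noncomputable section

/-- The entries of an invertible matrix, as a point at which polynomials in the matrix entries
can be evaluated. -/
def glEntries {n R : Type*} [Fintype n] [DecidableEq n] [CommRing R] (g : GL n R) :
    n × n → R :=
  fun x => (g : Matrix n n R) x.1 x.2

/-- The subgroup `H` of `GL_n(K)` is the zero locus in `GL_n(K)` of the finite family `P` of
polynomials with coefficients in the subfield `k`: it is a linear algebraic group defined over `k`,
and `P` is a system of defining equations of it. -/
def IsCutOutBy {n k K : Type*} [Fintype n] [DecidableEq n] [Field k] [Field K] [Algebra k K]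
    (H : Subgroup (GL n K)) {l : ℕ} (P : Fin l → MvPolynomial (n × n) k) : Prop :=
  ∀ g : GL n K, g ∈ H ↔ ∀ j, MvPolynomial.aeval (glEntries g) (P j) = 0

/-- For an `R`-algebra `S` with basis `b`, the map `ρ : M_n(S) → M_{nd}(R)` that replaces every
entry of a matrix by the matrix of its multiplication map with respect to `b`. -/
def blockRegular {n ι R S : Type*} [Fintype ι] [DecidableEq ι] [CommRing R] [CommRing S]
    [Algebra R S] (b : Module.Basis ι R S) (A : Matrix n n S) : Matrix (n × ι) (n × ι) R :=
  Matrix.of fun x y => Algebra.leftMulMatrix b (A x.1 y.1) x.2 y.2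

/-- `G ≤ GL_{nd}(K)` is the restriction of scalars from `k` to `F` of the `k`-defined group
`H ≤ GL_n(K)`, with respect to the basis `b` of `k` over `F`: it consists of the invertible
block matrices all of whose blocks lie in the `K`-span of the image of the regular representation
`k → M_d(F)`, and which satisfy the equations of `H`.  The `K`-span is the (isomorphic) image of
`K ⊗[F] k` under its regular representation `Algebra.leftMulMatrix`, so the equations
`P j` may be evaluated in `K ⊗[F] k`, where the coefficients of `P j` act through `k`. -/
def IsRestrictionOfScalars {n ι F k K : Type*} [Fintype n] [DecidableEq n] [Fintype ι]
    [DecidableEq ι] [Field F] [Field k] [Field K] [Algebra F k] [Algebra F K] [Algebra k K]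
    (b : Module.Basis ι F k) (H : Subgroup (GL n K)) (G : Subgroup (GL (n × ι) K)) : Prop :=
  ∃ (l : ℕ) (P : Fin l → MvPolynomial (n × n) k), IsCutOutBy H P ∧
    ∀ g : GL (n × ι) K, g ∈ G ↔
      ∃ z : Matrix n n (K ⊗[F] k),
        (g : Matrix (n × ι) (n × ι) K) = blockRegular (Algebra.TensorProduct.basis K b) z ∧
        ∀ j, MvPolynomial.eval₂
          (Algebra.TensorProduct.includeRight : k →ₐ[F] K ⊗[F] k).toRingHom
          (fun x => z x.1 x.2) (P j) = 0

/-- Reduction of elements of the fraction field `F` of `A` modulo the kernel of `φ : A → κ`: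
`c` is a fraction `a / d` with `φ d ≠ 0`, and `r = φ a / φ d`.  (For an integral domain `κ`
there is at most one such `r`, and there is none if `c` is not integral at the kernel of `φ`.) -/
def ReducesTo {A F κ : Type*} [CommRing A] [Field F] [Algebra A F] [CommRing κ] (φ : A →+* κ)
    (c : F) (r : κ) : Prop :=
  ∃ a d : A, φ d ≠ 0 ∧ c * algebraMap A F d = algebraMap A F a ∧ r * φ d = φ a

/-- The set of points in `GL_n(κ)` of the reduction along `φ : A → κ` of the system of equations
`P` over the fraction field `F` of `A`: the polynomials are reduced coefficient by coefficient. -/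
def reducedPoints {n A F κ : Type*} [Fintype n] [DecidableEq n] [CommRing A] [Field F]
    [Algebra A F] [CommRing κ] (φ : A →+* κ) {l : ℕ} (P : Fin l → MvPolynomial (n × n) F) :
    Set (GL n κ) :=
  {g | ∀ j, ∃ R : MvPolynomial (n × n) κ,
    (∀ m, ReducesTo φ ((P j).coeff m) (R.coeff m)) ∧ MvPolynomial.eval (glEntries g) R = 0}

/-- The prime ideals of the ring of integers of `k` dividing the rational prime `p`. -/
abbrev PrimeAbove (k : Type*) [Field k] [NumberField k] (p : ℕ) : Type _ :=
  {𝔭 : Ideal (𝓞 k) // 𝔭.IsPrime ∧ (p : 𝓞 k) ∈ 𝔭}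

end

/-! Choose an integral basis `ω` of $\mathcal O$ and an integer matrix `T` proportional to the
change of basis from `b` to `ω`. Conjugation by `T` turns the regular representation for `b` into
the one for `ω`, whose structure constants are integers. Over `K`, an invertible `g` lies in `G`
exactly when $TgT^{-1}$ has blocks $\sum_u z_u\rho(\omega_u)$ whose coordinates `z` satisfy the
integral equations obtained by expanding the equations of `H` along `ω` (`coordPolynomial`). These
`z` are determined by `g`, since a multiplication matrix is recovered from its value at $1$. So
"`(g, z)` solves the block equations" and "$Q(g)=0$ and `z` is the coordinate vector of `g`" are
integral systems in `(g, z)` with the same zeros over `K` where $\det g\ne0$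
(`isBlockSolution_iff_of_isRestrictionOfScalars`). By the Nullstellensatz they stay equivalent over
$\mathbb F_p$ for almost all $p$ (`exists_ne_zero_forall_isBlockSolution_iff`).

If $p$ does not divide the discriminant, the image of `ω` is an $\mathbb F_p$-basis of
$\prod_{\mathfrak p\mid p}\mathcal O/\mathfrak p$ (`ResidueProd.exists_basis`). The solutions over
$\mathbb F_p$ are then the matrices $T^{-1}\rho(Z)T$ with `Z` invertible over this product, and the
equations hold for `Z` exactly when they hold in each factor (`map_conjBlockRegular_eq`). As
$Z\mapsto T^{-1}\rho(Z)T$ is an injective homomorphism, this is the isomorphism. It is compatible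
with reduction because $\det T\cdot\rho(A)$ is an integer matrix (`reducesTo_blockRegular_iff`). -/

/-! ### Spreading out by the Nullstellensatz -/

open MvPolynomial in
/-- Spreading out an implication between systems of equations: if over an algebraically closed
field containing the domain `A` the common zeros of `S` outside the zeros of `h` are zeros of `f`,
then the same holds over all domains over `A` in which a fixed nonzero element of `A` survives. -/
theorem exists_ne_zero_forall_aeval_eq_zero {A K σ I : Type*} [CommRing A] [IsDomain A] [Field K]
    [IsAlgClosed K] [Algebra A K] [FaithfulSMul A K] [Finite σ] (S : I → MvPolynomial σ A)
    (h f : MvPolynomial σ A)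
    (H : ∀ x : σ → K, (∀ i, aeval x (S i) = 0) → aeval x h ≠ 0 → aeval x f = 0) :
    ∃ a : A, a ≠ 0 ∧ ∀ (κ : Type*) [CommRing κ] [IsDomain κ] [Algebra A κ], algebraMap A κ a ≠ 0 →
      ∀ x : σ → κ, (∀ i, aeval x (S i) = 0) → aeval x h ≠ 0 → aeval x f = 0 := by
  let F := FractionRing A
  let _ : Algebra F K := FractionRing.liftAlgebra A K
  have : IsScalarTower A F K := FractionRing.isScalarTower_liftAlgebra A K
  let _ : Algebra (MvPolynomial σ A) (MvPolynomial σ F) := MvPolynomial.algebraMvPolynomial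
  let J : Ideal (MvPolynomial σ A) := Ideal.span (Set.range S)
  let m : MvPolynomial σ A →+* MvPolynomial σ F := map (algebraMap A F)
  have hm : ∀ (x : σ → K) q, aeval x (m q) = aeval x q := fun x q => by
    exact aeval_map_algebraMap F x q
  -- The product $hf$ vanishes on all common zeros of `S` in `K`, so the Nullstellensatz over the
  -- fraction field puts a power of it into the ideal generated by `S`.
  have key : m (h * f) ∈ (J.map m).radical := by
    rw [← vanishingIdeal_zeroLocus_eq_radical (K := K), mem_vanishingIdeal_iff]
    intro x hx
    rw [hm, map_mul]
    by_cases hh : aeval x h = 0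
    · rw [hh, zero_mul]
    · rw [H x (fun i => ?_) hh, mul_zero]
      rw [← hm]
      exact hx _ (Ideal.mem_map_of_mem _ (Ideal.subset_span ⟨i, rfl⟩))
  obtain ⟨N, hN⟩ := key
  -- Clearing denominators: polynomials over `F` are the localization of those over `A` at the
  -- nonzero constants, so $(hf)^N a$ lies in `J` for some nonzero `a` in `A`.
  rw [show m = algebraMap (MvPolynomial σ A) (MvPolynomial σ F) from rfl,
    IsLocalization.mem_map_algebraMap_iff ((nonZeroDivisors A).map (C (σ := σ)))] at hN
  obtain ⟨⟨⟨q, hq⟩, ⟨s, a, ha, rfl⟩⟩, e⟩ := hN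
  have e' : (h * f) ^ N * C a = q := by
    apply (MvPolynomial.map_injective (algebraMap A F) (IsFractionRing.injective A F))
    rw [map_mul, map_pow]
    exact e
  refine ⟨a, nonZeroDivisors.ne_zero ha, fun κ _ _ _ hκ x hS hh => ?_⟩
  have hJ : J ≤ RingHom.ker (aeval x : MvPolynomial σ A →ₐ[A] κ) := by
    rw [Ideal.span_le]
    rintro _ ⟨i, rfl⟩
    exact hS i
  have : aeval x ((h * f) ^ N * C a) = 0 := by rw [e']; exact hJ hq
  rw [map_mul, map_pow, map_mul, algHom_C] at this
  exact (mul_eq_zero.1 (eq_zero_of_pow_eq_zero ((mul_eq_zero.1 this).resolve_right hκ))).resolve_left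
    hh

open MvPolynomial in
theorem exists_ne_zero_forall_forall_aeval_eq_zero {A K σ I J : Type*} [CommRing A] [IsDomain A]
    [Field K] [IsAlgClosed K] [Algebra A K] [FaithfulSMul A K] [Finite σ] [Fintype J]
    (S : I → MvPolynomial σ A) (h : MvPolynomial σ A) (f : J → MvPolynomial σ A)
    (H : ∀ x : σ → K, (∀ i, aeval x (S i) = 0) → aeval x h ≠ 0 → ∀ j, aeval x (f j) = 0) :
    ∃ a : A, a ≠ 0 ∧ ∀ (κ : Type*) [CommRing κ] [IsDomain κ] [Algebra A κ], algebraMap A κ a ≠ 0 →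
      ∀ x : σ → κ, (∀ i, aeval x (S i) = 0) → aeval x h ≠ 0 → ∀ j, aeval x (f j) = 0 := by
  choose a ha h' using fun j => exists_ne_zero_forall_aeval_eq_zero S h (f j)
    fun x hx hh => H x hx hh j
  refine ⟨∏ j, a j, Finset.prod_ne_zero_iff.2 fun j _ => ha j, fun κ _ _ _ hκ x hx hh j => ?_⟩
  rw [map_prod, Finset.prod_ne_zero_iff] at hκ
  exact h' j κ (hκ j (Finset.mem_univ j)) x hx hh

/-! ### Integral models of the equations and their reductions -/

open MvPolynomial in
/-- A finite family of polynomials over a fraction field has a common denominator. -/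
theorem exists_common_denominator {A F σ I : Type*} [CommRing A] [IsDomain A] [Field F]
    [Algebra A F] [IsFractionRing A F] [Finite I] (P : I → MvPolynomial σ F) :
    ∃ d : A, d ≠ 0 ∧ ∃ P' : I → MvPolynomial σ A,
      ∀ i, map (algebraMap A F) (P' i) = C (algebraMap A F d) * P i := by
  let _ : Algebra (MvPolynomial σ A) (MvPolynomial σ F) := MvPolynomial.algebraMvPolynomial
  obtain ⟨⟨_, d, hd, rfl⟩, h⟩ := IsLocalization.exist_integer_multiples_of_finite
    ((nonZeroDivisors A).map (C (σ := σ))) P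
  choose P' hP' using h
  refine ⟨d, nonZeroDivisors.ne_zero hd, P', fun i => ?_⟩
  rw [← map_C]
  exact (hP' i).trans (Algebra.smul_def _ _)

/-- Reduction of a fraction with a known denominator. -/
theorem reducesTo_iff {A F κ : Type*} [CommRing A] [IsDomain A] [Field F] [Algebra A F]
    [IsFractionRing A F] [CommRing κ] [IsDomain κ] (φ : A →+* κ) {c : F} {a d : A} (hd : φ d ≠ 0)
    (h : c * algebraMap A F d = algebraMap A F a) (r : κ) :
    ReducesTo φ c r ↔ r * φ d = φ a := by
  refine ⟨?_, fun hr => ⟨a, d, hd, h, hr⟩⟩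
  rintro ⟨a', d', hd', h', hr⟩
  have : a * d' = a' * d := by
    apply IsFractionRing.injective A F
    rw [map_mul, map_mul, ← h, ← h']; ring
  have h2 := congrArg φ this
  rw [map_mul, map_mul, ← hr] at h2
  exact mul_right_cancel₀ hd' (by rw [h2]; ring)

open MvPolynomial in
/-- The points of the reduction are the zeros of any integral multiple of the system whose
multiplier is not reduced to zero. -/
theorem mem_reducedPoints_iff {n A F κ : Type*} [Fintype n] [DecidableEq n] [CommRing A]
    [IsDomain A] [Field F] [Algebra A F] [IsFractionRing A F] [CommRing κ] [IsDomain κ]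
    [Algebra A κ] {l : ℕ} {P : Fin l → MvPolynomial (n × n) F}
    {P' : Fin l → MvPolynomial (n × n) A} {d : A} (hd : IsUnit (algebraMap A κ d))
    (h : ∀ i, map (algebraMap A F) (P' i) = C (algebraMap A F d) * P i) (g : GL n κ) :
    g ∈ reducedPoints (algebraMap A κ) P ↔ ∀ i, aeval (glEntries g) (P' i) = 0 := by
  have hc : ∀ i m, (P i).coeff m * algebraMap A F d = algebraMap A F ((P' i).coeff m) := by
    intro i m
    rw [← coeff_map, h, coeff_C_mul, mul_comm]
  refine forall_congr' fun i => ⟨?_, fun hg => ?_⟩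
  · rintro ⟨R, hR, hg⟩
    have : map (algebraMap A κ) (P' i) = C (algebraMap A κ d) * R := by
      ext m
      rw [coeff_map, coeff_C_mul, ← (reducesTo_iff _ hd.ne_zero (hc i m) _).1 (hR m), mul_comm]
    rw [aeval_def, eval₂_eq_eval_map, this, map_mul, hg, mul_zero]
  · obtain ⟨u, hu⟩ := hd
    refine ⟨C (↑u⁻¹ : κ) * map (algebraMap A κ) (P' i), fun m => ?_, ?_⟩
    · rw [reducesTo_iff _ (hu ▸ u.ne_zero) (hc i m), ← hu, coeff_C_mul, coeff_map]
      rw [mul_right_comm, Units.inv_mul, one_mul]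
    · rw [map_mul, ← eval₂_eq_eval_map, ← aeval_def, hg, mul_zero]

open MvPolynomial in
theorem isCutOutBy_iff_aeval {n A k K : Type*} [Fintype n] [DecidableEq n] [CommRing A] [IsDomain A]
    [Field k] [Field K] [Algebra A k] [IsFractionRing A k] [Algebra k K] [Algebra A K]
    [IsScalarTower A k K] {H : Subgroup (GL n K)} {l : ℕ} {P : Fin l → MvPolynomial (n × n) k}
    (hP : IsCutOutBy H P) {P' : Fin l → MvPolynomial (n × n) A} {d : A} (hd : d ≠ 0)
    (h : ∀ i, map (algebraMap A k) (P' i) = C (algebraMap A k d) * P i) (g : GL n K) :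
    g ∈ H ↔ ∀ i, aeval (glEntries g) (P' i) = 0 := by
  rw [hP g]
  refine forall_congr' fun i => ?_
  rw [← aeval_map_algebraMap k (glEntries g) (P' i), h, map_mul, algHom_C, mul_eq_zero, or_iff_right]
  rw [← IsScalarTower.algebraMap_apply]
  have : Function.Injective (algebraMap A K) := by
    rw [IsScalarTower.algebraMap_eq A k K]
    exact (algebraMap k K).injective.comp (IsFractionRing.injective A k)
  simpa using fun hh => hd (this (by simpa using hh))

/-! ### Residue rings of the primes above an unramified p -/

/-- If `p` does not divide the discriminant, then `p` generates the intersection of the primes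
above it. -/
theorem ker_pi_quotient_of_not_dvd_discr {k ι : Type*} [Field k] [NumberField k] [Fintype ι]
    [DecidableEq ι] (ω : Module.Basis ι ℤ (𝓞 k)) {p : ℕ} [Fact p.Prime]
    (hp : ¬ (p : ℤ) ∣ Algebra.discr ℤ ω) {x : 𝓞 k} (hx : ∀ 𝔭 : PrimeAbove k p, x ∈ 𝔭.1) (u : ι) :
    (p : ℤ) ∣ ω.repr x u := by
  have hrad : x ∈ (Ideal.span {(p : 𝓞 k)}).radical := by
    rw [Ideal.radical_eq_sInf, Submodule.mem_sInf]
    rintro 𝔭 ⟨h1, h2⟩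
    exact hx ⟨𝔭, h2, h1 (Ideal.mem_span_singleton_self _)⟩
  obtain ⟨N, hN⟩ := hrad
  obtain ⟨y, hy⟩ := Ideal.mem_span_singleton.1 hN
  -- Since $x^N\in p\mathcal O$, multiplication by $xv$ is nilpotent modulo $p$ and has trace zero
  -- there.
  have htr : ∀ v : 𝓞 k, ((Algebra.trace ℤ (𝓞 k) (x * v) : ℤ) : ZMod p) = 0 := by
    intro v
    let f : Matrix ι ι ℤ →+* Matrix ι ι (ZMod p) := (Int.castRingHom (ZMod p)).mapMatrix
    have hnil : IsNilpotent (f (Algebra.leftMulMatrix ω (x * v))) := by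
      refine ⟨N, ?_⟩
      rw [← map_pow, ← map_pow, mul_pow, hy, mul_assoc, map_mul, map_natCast, map_mul, map_natCast]
      have : ((p : ℕ) : Matrix ι ι (ZMod p)) = 0 := by
        ext i j
        simp [Matrix.natCast_apply]
      rw [this, zero_mul]
    have := (Matrix.isNilpotent_trace_of_isNilpotent hnil).eq_zero
    rw [Algebra.trace_eq_matrix_trace ω]
    rw [← this]
    exact AddMonoidHom.map_trace (Int.castRingHom (ZMod p)).toAddMonoidHom _
  let f : Matrix ι ι ℤ →+* Matrix ι ι (ZMod p) := (Int.castRingHom (ZMod p)).mapMatrix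
  have hdet : (f (Algebra.traceMatrix ℤ ω)).det ≠ 0 := by
    rw [← RingHom.map_det]
    intro h
    exact hp ((ZMod.intCast_zmod_eq_zero_iff_dvd _ _).1 h)
  -- The vanishing traces say that the trace matrix kills the coordinate vector of `x` modulo $p$;
  -- its determinant is the discriminant, a unit modulo $p$.
  have hvec : (f (Algebra.traceMatrix ℤ ω)).mulVec (fun u => ((ω.repr x u : ℤ) : ZMod p)) = 0 := by
    ext v
    rw [Pi.zero_apply, ← htr (ω v), Matrix.mulVec, dotProduct]
    conv_rhs => rw [← ω.sum_repr x]
    rw [Finset.sum_mul, map_sum, Int.cast_sum]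
    refine Finset.sum_congr rfl fun u _ => ?_
    rw [smul_mul_assoc, map_smul, smul_eq_mul, Int.cast_mul, mul_comm, mul_comm (ω u)]
    rfl
  have := congrFun (Matrix.eq_zero_of_mulVec_eq_zero hdet hvec) u
  exact (ZMod.intCast_zmod_eq_zero_iff_dvd _ _).1 this

theorem PrimeAbove.isMaximal {k : Type*} [Field k] [NumberField k] {p : ℕ} (hp : p.Prime)
    (𝔭 : PrimeAbove k p) : 𝔭.1.IsMaximal :=
  have := 𝔭.2.1
  Ring.DimensionLEOne.maximalOfPrime (fun h => hp.ne_zero (by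
    have := 𝔭.2.2
    rw [h] at this
    simpa using this)) 𝔭.2.1

theorem PrimeAbove.intCast_mem_iff {k : Type*} [Field k] [NumberField k] {p : ℕ} (hp : p.Prime)
    (𝔭 : PrimeAbove k p) (a : ℤ) : (a : 𝓞 k) ∈ 𝔭.1 ↔ (p : ℤ) ∣ a := by
  constructor
  · intro h
    by_contra hd
    have hc : IsCoprime (p : ℤ) a :=
      (Nat.prime_iff_prime_int.1 hp).coprime_iff_not_dvd.2 hd
    obtain ⟨r, s, hrs⟩ := hc
    refine 𝔭.2.1.ne_top ((Ideal.eq_top_iff_one _).2 ?_)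
    have : (1 : 𝓞 k) = r * (p : 𝓞 k) + s * a := by exact_mod_cast congrArg (Int.cast (R := 𝓞 k)) hrs.symm
    rw [this]
    exact 𝔭.1.add_mem (𝔭.1.mul_mem_left _ 𝔭.2.2) (𝔭.1.mul_mem_left _ h)
  · rintro ⟨c, rfl⟩
    rw [Int.cast_mul]
    exact 𝔭.1.mul_mem_right _ (by simpa using 𝔭.2.2)

theorem PrimeAbove.finite (k : Type*) [Field k] [NumberField k] {p : ℕ} (hp : p.Prime) :
    Finite (PrimeAbove k p) := by
  have hp' : Ideal.span {(p : 𝓞 k)} ≠ 0 := by simpa using hp.ne_zero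
  have := (Ideal.finite_factors hp').to_subtype
  refine Finite.of_injective (β := {v : IsDedekindDomain.HeightOneSpectrum (𝓞 k) |
    v.asIdeal ∣ Ideal.span {(p : 𝓞 k)}}) (fun 𝔭 => ⟨⟨𝔭.1, 𝔭.2.1, fun h => hp.ne_zero ?_⟩, ?_⟩) ?_
  · have := 𝔭.2.2
    rw [h] at this
    simpa using this
  · exact Ideal.dvd_iff_le.2 ((Ideal.span_singleton_le_iff_mem _).2 𝔭.2.2)
  · intro 𝔭 𝔮 h
    exact Subtype.ext (congrArg (fun v => v.1.asIdeal) h)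

/-- A surjection `𝓞 → S` onto an `𝔽_p`-algebra with kernel `p𝓞` maps integral bases to bases. -/
theorem exists_basis_of_surjective {O S ι : Type*} [CommRing O] [CommRing S] [Finite ι] {p : ℕ}
    [Algebra (ZMod p) S] (ω : Module.Basis ι ℤ O) (j : O →+* S) (hj : Function.Surjective j)
    (hker : ∀ x, j x = 0 → ∀ u, (p : ℤ) ∣ ω.repr x u) :
    ∃ β : Module.Basis ι (ZMod p) S, ∀ u, β u = j (ω u) := by
  have := Fintype.ofFinite ι
  have hsum (c : ι → ℤ) : j (∑ u, c u • ω u) = ∑ u, (c u : ZMod p) • j (ω u) := by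
    rw [map_sum]
    refine Finset.sum_congr rfl fun u _ => ?_
    rw [map_zsmul, Int.cast_smul_eq_zsmul]
  refine ⟨Module.Basis.mk (v := fun u => j (ω u)) ?_ ?_, fun u => Module.Basis.mk_apply _ _ u⟩
  · rw [Fintype.linearIndependent_iff]
    intro c hc u
    choose a ha using fun u => ZMod.intCast_surjective (c u)
    have := hker (∑ u, a u • ω u) (by rw [hsum]; simpa only [ha] using hc) u
    rw [ω.repr_sum_self] at this
    rw [← ha, (ZMod.intCast_zmod_eq_zero_iff_dvd _ _).2 this]
  · rintro y -
    obtain ⟨x, rfl⟩ := hj y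
    rw [← ω.sum_repr x, hsum]
    exact Submodule.sum_mem _ fun u _ => Submodule.smul_mem _ _ (Submodule.subset_span ⟨u, rfl⟩)

/-- The product of the residue rings of the primes above `p`. -/
def ResidueProd (k : Type*) [Field k] [NumberField k] (p : ℕ) : Type _ :=
  ∀ 𝔭 : PrimeAbove k p, 𝓞 k ⧸ 𝔭.1

noncomputable instance (k : Type*) [Field k] [NumberField k] (p : ℕ) :
    CommRing (ResidueProd k p) :=
  inferInstanceAs (CommRing (∀ 𝔭 : PrimeAbove k p, 𝓞 k ⧸ 𝔭.1))

/-- The diagonal reduction map. -/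
noncomputable def ResidueProd.diag (k : Type*) [Field k] [NumberField k] (p : ℕ) :
    𝓞 k →+* ResidueProd k p :=
  RingHom.pi fun 𝔭 : PrimeAbove k p => Ideal.Quotient.mk 𝔭.1

/-- The projection to a residue ring. -/
noncomputable def ResidueProd.proj {k : Type*} [Field k] [NumberField k] {p : ℕ}
    (𝔭 : PrimeAbove k p) : ResidueProd k p →+* 𝓞 k ⧸ 𝔭.1 :=
  Pi.evalRingHom (fun 𝔭 : PrimeAbove k p => 𝓞 k ⧸ 𝔭.1) 𝔭

theorem ResidueProd.diag_surjective (k : Type*) [Field k] [NumberField k] {p : ℕ} (hp : p.Prime) :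
    Function.Surjective (ResidueProd.diag k p) := by
  intro y
  have : Finite (PrimeAbove k p) := PrimeAbove.finite k hp
  obtain ⟨z, hz⟩ := Ideal.quotientInfToPiQuotient_surj
    (I := fun 𝔭 : PrimeAbove k p => 𝔭.1) (fun 𝔭 𝔮 h => by
      have := 𝔭.isMaximal hp
      have := 𝔮.isMaximal hp
      exact Ideal.isCoprime_of_isMaximal fun h' => h (Subtype.ext h')) y
  obtain ⟨x, rfl⟩ := Ideal.Quotient.mk_surjective z
  exact ⟨x, hz⟩

theorem PrimeAbove.charP {k : Type*} [Field k] [NumberField k] {p : ℕ} (hp : p.Prime)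
    (𝔭 : PrimeAbove k p) : CharP (𝓞 k ⧸ 𝔭.1) p :=
  ⟨fun x => by
    rw [← map_natCast (Ideal.Quotient.mk 𝔭.1), Ideal.Quotient.eq_zero_iff_mem, ← Int.natCast_dvd_natCast,
      ← 𝔭.intCast_mem_iff hp, Int.cast_natCast]⟩

/-- `∏ 𝓞 / 𝔭` is an algebra over `𝔽_p`. -/
@[reducible]
noncomputable def ResidueProd.algebra (k : Type*) [Field k] [NumberField k] {p : ℕ}
    (hp : p.Prime) : Algebra (ZMod p) (ResidueProd k p) :=
  RingHom.toAlgebra (RingHom.pi fun 𝔭 : PrimeAbove k p =>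
    have := 𝔭.charP hp
    ZMod.castHom (dvd_refl p) (𝓞 k ⧸ 𝔭.1))

/-- For unramified `p`, the image of an integral basis is a basis of `∏ 𝓞 / 𝔭` over `𝔽_p`. -/
theorem ResidueProd.exists_basis {k ι : Type*} [Field k] [NumberField k] [Fintype ι]
    [DecidableEq ι] (ω : Module.Basis ι ℤ (𝓞 k)) {p : ℕ} (hp : p.Prime)
    [Algebra (ZMod p) (ResidueProd k p)] (hd : ¬ (p : ℤ) ∣ Algebra.discr ℤ ω) :
    ∃ β : Module.Basis ι (ZMod p) (ResidueProd k p), ∀ u, β u = ResidueProd.diag k p (ω u) :=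
  have : Fact p.Prime := ⟨hp⟩
  exists_basis_of_surjective ω _ (ResidueProd.diag_surjective k hp) fun _ hx =>
    ker_pi_quotient_of_not_dvd_discr ω hd
      fun 𝔭 => Ideal.Quotient.eq_zero_iff_mem.1 (congrArg (ResidueProd.proj 𝔭) hx)

/-- Turns the condition that `a` survive modulo every prime above $p$ into the condition $p\nmid N$
on $p$ alone. The norm of the ideal $(a)$ serves, as it lies in that ideal. -/
theorem exists_intCast_dvd {k : Type*} [Field k] [NumberField k] {a : 𝓞 k} (ha : a ≠ 0) :
    ∃ N : ℤ, N ≠ 0 ∧ a ∣ N := by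
  refine ⟨Ideal.absNorm (Ideal.span {a}), ?_, ?_⟩
  · rw [Nat.cast_ne_zero, Ne, Ideal.absNorm_eq_zero_iff]
    simpa using ha
  · rw [← Ideal.mem_span_singleton]
    exact_mod_cast Ideal.absNorm_mem _

/-! ### Block matrices and equations in coordinates -/

section BaseChange

variable {n ι ν O R S : Type*} [Fintype ι] [DecidableEq ι] [CommRing O] [CommRing R] [CommRing S]
  [Algebra R S] (ω : Module.Basis ι ℤ O) (β : Module.Basis ι R S) (j : O →+* S)

/-- The block matrix with blocks `∑ z u • ρ(ω u)`. -/
noncomputable def genericBlock (z : (n × n) × ι → R) : Matrix (n × ι) (n × ι) R :=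
  Matrix.of fun x y => ∑ u, z ((x.1, y.1), u) * (Algebra.leftMulMatrix ω (ω u) x.2 y.2 : R)

/-- The matrix over `S` with coordinates `z` with respect to the basis `β`. -/
noncomputable def ofCoords (z : (n × n) × ι → R) : Matrix n n S :=
  Matrix.of fun s t => ∑ u, z ((s, t), u) • β u

theorem exists_ofCoords (Z : Matrix n n S) : ∃ z : (n × n) × ι → R, ofCoords β z = Z :=
  ⟨fun v => β.repr (Z v.1.1 v.1.2) v.2, by ext s t; exact β.sum_repr (Z s t)⟩

theorem repr_baseChange (hj : ∀ u, j (ω u) = β u) (x : O) (u : ι) :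
    β.repr (j x) u = (ω.repr x u : R) := by
  conv_lhs => rw [← ω.sum_repr x]
  simp only [map_sum, map_zsmul, hj, ← Int.cast_smul_eq_zsmul R, map_smul, β.repr_self]
  simp [Finsupp.single_apply]

theorem leftMulMatrix_baseChange (hj : ∀ u, j (ω u) = β u) (x : O) :
    Algebra.leftMulMatrix β (j x) = (Algebra.leftMulMatrix ω x).map (Int.cast : ℤ → R) := by
  ext u v
  rw [Matrix.map_apply, Algebra.leftMulMatrix_eq_repr_mul, Algebra.leftMulMatrix_eq_repr_mul, ← hj,
    ← map_mul, repr_baseChange ω β j hj]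

theorem blockRegular_ofCoords (hj : ∀ u, j (ω u) = β u) (z : (n × n) × ι → R) :
    blockRegular β (ofCoords β z) = genericBlock ω z := by
  ext x y
  simp [blockRegular, ofCoords, genericBlock, ← hj, leftMulMatrix_baseChange ω β j hj,
    Matrix.sum_apply]

/-- A multiplication matrix applied to the coordinates of $1$ returns the coordinates of the
multiplier. Hence `z` is recovered linearly from its block matrix, even if $1$ is not a basis
vector. -/
theorem sum_genericBlock_mul_repr_one (hj : ∀ u, j (ω u) = β u) (z : (n × n) × ι → R) (s t : n)
    (u : ι) : ∑ i, genericBlock ω z (s, u) (t, i) * (ω.repr 1 i : R) = z ((s, t), u) := by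
  have := congrFun (Algebra.leftMulMatrix_mulVec_repr β (ofCoords β z s t) 1) u
  rw [mul_one, ofCoords, Matrix.of_apply, β.repr_sum_self] at this
  rw [← this, ← blockRegular_ofCoords ω β j hj, Matrix.mulVec, dotProduct]
  refine Finset.sum_congr rfl fun i _ => ?_
  rw [← repr_baseChange ω β j hj, map_one]
  rfl

theorem genericBlock_map {R' : Type*} [CommRing R'] (f : R →+* R') (z : (n × n) × ι → R) :
    (genericBlock ω z).map f = genericBlock ω (f ∘ z) := by
  ext x y
  simp [genericBlock]

open MvPolynomial in
/-- The coordinates of a polynomial over `O` as polynomials over `ℤ` in the coordinates of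
the variables. -/
noncomputable def coordPolynomial (P : MvPolynomial ν O) (u : ι) : MvPolynomial (ν × ι) ℤ :=
  (Algebra.TensorProduct.basis (MvPolynomial (ν × ι) ℤ) ω).repr
    (eval₂ (Algebra.TensorProduct.includeRight :
        O →ₐ[ℤ] MvPolynomial (ν × ι) ℤ ⊗[ℤ] O).toRingHom
      (fun x => ∑ u, (X (x, u) : MvPolynomial (ν × ι) ℤ) ⊗ₜ[ℤ] ω u) P) u

open MvPolynomial in
-- The coordinate polynomials are the expansion at the generic point with values in $\mathbb
-- Z[X]\otimes\mathcal O$; specializing $X\mapsto z$ and applying `j` on the second factor gives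
-- every other case. The same integral equations thus serve over `K` and over $\mathbb F_p$.
theorem eval₂_eq_sum_coordPolynomial (hj : ∀ u, j (ω u) = β u) (P : MvPolynomial ν O)
    (z : ν × ι → R) :
    eval₂ j (fun x => ∑ u, z (x, u) • β u) P = ∑ u, aeval z (coordPolynomial ω P u) • β u := by
  let f : MvPolynomial (ν × ι) ℤ ⊗[ℤ] O →ₐ[ℤ] S :=
    Algebra.TensorProduct.lift (((Algebra.ofId R S).restrictScalars ℤ).comp (aeval z))
      j.toIntAlgHom (fun _ _ => Commute.all _ _)
  have hf : ∀ q x, f (q ⊗ₜ x) = aeval z q • j x := fun q x => by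
    simp [f, Algebra.smul_def, Algebra.ofId_apply]
  have := congrArg f ((Algebra.TensorProduct.basis (MvPolynomial (ν × ι) ℤ) ω).sum_repr
    (eval₂ (Algebra.TensorProduct.includeRight :
        O →ₐ[ℤ] MvPolynomial (ν × ι) ℤ ⊗[ℤ] O).toRingHom
      (fun x => ∑ u, (X (x, u) : MvPolynomial (ν × ι) ℤ) ⊗ₜ[ℤ] ω u) P))
  rw [map_sum, ← AlgHom.coe_toRingHom f, hom_eval₂] at this
  convert this.symm using 2
  · ext x
    simp [hf]
  · ext x
    simp [hf, hj]
  · rename_i u _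
    rw [Algebra.TensorProduct.basis_apply, TensorProduct.smul_tmul', AlgHom.coe_toRingHom, hf, hj,
      smul_eq_mul, mul_one]
    rfl

open MvPolynomial in
theorem eval₂_ofCoords_eq_zero_iff (hj : ∀ u, j (ω u) = β u) (P : MvPolynomial (n × n) O)
    (z : (n × n) × ι → R) :
    eval₂ j (fun x => ofCoords β z x.1 x.2) P = 0 ↔
      ∀ u, aeval z (coordPolynomial ω P u) = 0 := by
  have := eval₂_eq_sum_coordPolynomial ω β j hj P z
  rw [show (fun x : n × n => ofCoords β z x.1 x.2) = fun x => ∑ u, z (x, u) • β u from rfl, this]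
  refine ⟨fun h u => ?_, fun h => Finset.sum_eq_zero fun u _ => by rw [h u, zero_smul]⟩
  have := congrArg (fun y => β.repr y u) h
  simpa only [β.repr_sum_self, map_zero, Finsupp.zero_apply] using this

end BaseChange

/-! ### Block matrices as a ring, and change of basis -/

section Block

variable {n ι R S : Type*} [Fintype n] [DecidableEq n] [Fintype ι] [DecidableEq ι] [CommRing R]
  [CommRing S] [Algebra R S]

/-- `blockRegular` as a ring homomorphism. -/
noncomputable def blockRegularHom (n : Type*) [Fintype n] [DecidableEq n] (b : Module.Basis ι R S) :
    Matrix n n S →+* Matrix (n × ι) (n × ι) R :=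
  (Matrix.compRingEquiv n ι R).toRingHom.comp (Algebra.leftMulMatrix b).toRingHom.mapMatrix

theorem blockRegularHom_apply (b : Module.Basis ι R S) (A : Matrix n n S) :
    blockRegularHom n b A = blockRegular b A :=
  rfl

theorem blockRegularHom_injective (b : Module.Basis ι R S) :
    Function.Injective (blockRegularHom n b) := by
  intro A B h
  have : A.map (Algebra.leftMulMatrix b) = B.map (Algebra.leftMulMatrix b) :=
    (Matrix.compRingEquiv n ι R).injective h
  ext s t
  exact Algebra.leftMulMatrix_injective b (congrFun (congrFun this s) t)

/-- The block diagonal matrix all of whose diagonal blocks are `T`. -/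
noncomputable def blockScalar (n : Type*) [Fintype n] [DecidableEq n] :
    Matrix ι ι R →+* Matrix (n × ι) (n × ι) R :=
  (Matrix.compRingEquiv n ι R).toRingHom.comp (Matrix.scalar n)

theorem blockScalar_apply (T : Matrix ι ι R) (x y : n × ι) :
    blockScalar n T x y = if x.1 = y.1 then T x.2 y.2 else 0 := by
  change (Matrix.diagonal fun _ : n => T) x.1 y.1 x.2 y.2 = _
  by_cases h : x.1 = y.1
  · rw [if_pos h, h, Matrix.diagonal_apply_eq]
  · rw [if_neg h, Matrix.diagonal_apply_ne _ h]
    rfl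

theorem blockScalar_map {R' : Type*} [CommRing R'] (f : R →+* R') (T : Matrix ι ι R) :
    (blockScalar n T).map f = blockScalar n (T.map f) := by
  ext x y
  simp only [Matrix.map_apply, blockScalar_apply, apply_ite f, map_zero]

theorem blockScalar_smul_one (c : R) : blockScalar n (c • (1 : Matrix ι ι R)) = c • 1 := by
  ext ⟨s, i⟩ ⟨t, j⟩
  by_cases h : s = t <;> by_cases h' : i = j <;> simp [blockScalar_apply, h, h']

theorem toMatrix_mul_leftMulMatrix (b c : Module.Basis ι R S) (x : S) :
    c.toMatrix b * Algebra.leftMulMatrix b x = Algebra.leftMulMatrix c x * c.toMatrix b := by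
  rw [Algebra.leftMulMatrix_apply, Algebra.leftMulMatrix_apply,
    basis_toMatrix_mul_linearMap_toMatrix, linearMap_toMatrix_mul_basis_toMatrix]

theorem blockScalar_mul_blockRegular {b c : Module.Basis ι R S} {T : Matrix ι ι R}
    (hT : ∀ x, T * Algebra.leftMulMatrix b x = Algebra.leftMulMatrix c x * T) (A : Matrix n n S) :
    blockScalar n T * blockRegular b A = blockRegular c A * blockScalar n T := by
  rw [← blockRegularHom_apply, ← blockRegularHom_apply, blockScalar, blockRegularHom,
    blockRegularHom, RingHom.comp_apply, RingHom.comp_apply, RingHom.comp_apply, ← map_mul,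
    ← map_mul]
  congr 1
  ext s t : 2
  simp [Matrix.scalar_apply, hT]

end Block

open MvPolynomial in
/-- If two systems of equations are equivalent outside the zeros of `h` over an algebraically closed
field, then they are equivalent over all domains in which a fixed nonzero element survives. -/
theorem exists_ne_zero_forall_aeval_iff {A K σ I J : Type*} [CommRing A] [IsDomain A]
    [Field K] [IsAlgClosed K] [Algebra A K] [FaithfulSMul A K] [Finite σ] [Fintype I] [Fintype J]
    (S : I → MvPolynomial σ A) (f : J → MvPolynomial σ A) (h : MvPolynomial σ A)
    (H : ∀ x : σ → K, aeval x h ≠ 0 → ((∀ i, aeval x (S i) = 0) ↔ ∀ j, aeval x (f j) = 0)) :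
    ∃ a : A, a ≠ 0 ∧ ∀ (κ : Type*) [CommRing κ] [IsDomain κ] [Algebra A κ], algebraMap A κ a ≠ 0 →
      ∀ x : σ → κ, aeval x h ≠ 0 → ((∀ i, aeval x (S i) = 0) ↔ ∀ j, aeval x (f j) = 0) := by
  obtain ⟨a, ha, h1⟩ := exists_ne_zero_forall_forall_aeval_eq_zero S h f
    fun x hx hh => (H x hh).1 hx
  obtain ⟨a', ha', h2⟩ := exists_ne_zero_forall_forall_aeval_eq_zero f h S
    fun x hx hh => (H x hh).2 hx
  refine ⟨a * a', mul_ne_zero ha ha', fun κ _ _ _ hκ x hh => ?_⟩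
  rw [map_mul] at hκ
  exact ⟨fun hx => h1 κ (left_ne_zero_of_mul hκ) x hx hh,
    fun hx => h2 κ (right_ne_zero_of_mul hκ) x hx hh⟩

/-! ### An integral matrix for the change of basis -/

section Rational

variable {k ι : Type*} [Field k] [NumberField k] [Fintype ι] [DecidableEq ι]

/-- An integral basis as a basis of the number field. -/
noncomputable def rationalBasis (ω : Module.Basis ι ℤ (𝓞 k)) : Module.Basis ι ℚ k :=
  ω.localizationLocalization ℚ (nonZeroDivisors ℤ) k

theorem rationalBasis_apply (ω : Module.Basis ι ℤ (𝓞 k)) (u : ι) :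
    rationalBasis ω u = algebraMap (𝓞 k) k (ω u) :=
  ω.localizationLocalization_apply ..

/-- A common denominator `c` of the change of basis matrix is absorbed into `T`. Only
proportionality matters, because the scalar cancels in the intertwining relation. -/
theorem exists_integral_toMatrix (ω : Module.Basis ι ℤ (𝓞 k)) (b : Module.Basis ι ℚ k) :
    ∃ (T : Matrix ι ι ℤ) (c : ℚ), c ≠ 0 ∧ T.det ≠ 0 ∧
      T.map (Int.cast : ℤ → ℚ) = c • (rationalBasis ω).toMatrix b := by
  obtain ⟨⟨c, hc⟩, h⟩ := IsLocalization.exist_integer_multiples_of_finite (nonZeroDivisors ℤ)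
    fun x : ι × ι => (rationalBasis ω).toMatrix b x.1 x.2
  choose T hT using h
  have hc' : (c : ℚ) ≠ 0 := Int.cast_ne_zero.2 (nonZeroDivisors.ne_zero hc)
  have e : (Matrix.of fun x y => T (x, y)).map (Int.cast : ℤ → ℚ) =
      (c : ℚ) • (rationalBasis ω).toMatrix b := by
    ext x y
    rw [Matrix.map_apply, Matrix.of_apply, Matrix.smul_apply, Int.cast_smul_eq_zsmul]
    exact hT (x, y)
  refine ⟨Matrix.of fun x y => T (x, y), c, hc', fun h0 => ?_, e⟩
  have h1 := congrArg Matrix.det e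
  rw [show ((Matrix.of fun x y => T (x, y)).map (Int.cast : ℤ → ℚ)).det = _ from
    ((Int.castRingHom ℚ).map_det _).symm, h0, map_zero, Matrix.det_smul] at h1
  have h2 := congrArg Matrix.det (Module.Basis.toMatrix_mul_toMatrix_flip b (rationalBasis ω))
  rw [Matrix.det_mul, Matrix.det_one] at h2
  exact mul_ne_zero (pow_ne_zero _ hc') (right_ne_zero_of_mul_eq_one h2) h1.symm

theorem map_mul_leftMulMatrix {ω : Module.Basis ι ℤ (𝓞 k)} {b : Module.Basis ι ℚ k}
    {T : Matrix ι ι ℤ} {c : ℚ} (hT : T.map (Int.cast : ℤ → ℚ) = c • (rationalBasis ω).toMatrix b)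
    (x : k) : T.map (Int.cast : ℤ → ℚ) * Algebra.leftMulMatrix b x =
      Algebra.leftMulMatrix (rationalBasis ω) x * T.map (Int.cast : ℤ → ℚ) := by
  rw [hT, Matrix.smul_mul, toMatrix_mul_leftMulMatrix, Matrix.mul_smul]

theorem map_mul_leftMulMatrix_tensor {K : Type*} [Field K] [CharZero K]
    {ω : Module.Basis ι ℤ (𝓞 k)} {b : Module.Basis ι ℚ k}
    {T : Matrix ι ι ℤ} {c : ℚ} (hT : T.map (Int.cast : ℤ → ℚ) = c • (rationalBasis ω).toMatrix b)
    (x : K ⊗[ℚ] k) :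
    T.map (Int.cast : ℤ → K) * Algebra.leftMulMatrix (Algebra.TensorProduct.basis K b) x =
      Algebra.leftMulMatrix (Algebra.TensorProduct.basis K (rationalBasis ω)) x *
        T.map (Int.cast : ℤ → K) := by
  have : T.map (Int.cast : ℤ → K) = (c : K) • (Algebra.TensorProduct.basis K
      (rationalBasis ω)).toMatrix (Algebra.TensorProduct.basis K b) := by
    ext i j
    have := congrArg (Rat.cast : ℚ → K) (congrFun (congrFun hT i) j)
    simpa [Module.Basis.toMatrix_apply] using this
  rw [this, Matrix.smul_mul, toMatrix_mul_leftMulMatrix, Matrix.mul_smul]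

end Rational

theorem blockScalar_mul_adjugate (n : Type*) {ι R : Type*} [Fintype n] [DecidableEq n] [Fintype ι]
    [DecidableEq ι] [CommRing R] (T : Matrix ι ι R) :
    blockScalar n T * blockScalar n T.adjugate = T.det • 1 := by
  rw [← map_mul, Matrix.mul_adjugate, blockScalar_smul_one]

theorem blockScalar_adjugate_mul (n : Type*) {ι R : Type*} [Fintype n] [DecidableEq n] [Fintype ι]
    [DecidableEq ι] [CommRing R] (T : Matrix ι ι R) :
    blockScalar n T.adjugate * blockScalar n T = T.det • 1 := by
  rw [← map_mul, Matrix.adjugate_mul, blockScalar_smul_one]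

theorem blockScalar_mul_left_cancel {n ι R : Type*} [Fintype n] [DecidableEq n] [Fintype ι]
    [DecidableEq ι] [CommRing R] [IsDomain R] {T : Matrix ι ι R} (hT : T.det ≠ 0)
    {M N : Matrix (n × ι) (n × ι) R} (h : blockScalar n T * M = blockScalar n T * N) : M = N := by
  have := congrArg (blockScalar n T.adjugate * ·) h
  simp only [← mul_assoc, blockScalar_adjugate_mul, smul_mul_assoc, one_mul] at this
  exact smul_right_injective _ hT this

/-! ### The two integral systems in the variables (g, z) -/

section Spread

variable {n ι R : Type*} [Fintype n] [DecidableEq n] [Fintype ι] [DecidableEq ι] [CommRing R]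
  {O : Type*} [CommRing O] (ω : Module.Basis ι ℤ O) (T : Matrix ι ι ℤ)

open MvPolynomial in
/-- The statement that `T g T⁻¹` is the block matrix with coordinates `z`, and that `z`
satisfies the coordinate equations of the polynomials `P`. -/
def IsBlockSolution {l : ℕ} (P : Fin l → MvPolynomial (n × n) O)
    (g : Matrix (n × ι) (n × ι) R) (z : (n × n) × ι → R) : Prop :=
  blockScalar n (T.map (Int.cast : ℤ → R)) * g =
      genericBlock ω z * blockScalar n (T.map (Int.cast : ℤ → R)) ∧
    ∀ j u, aeval z (coordPolynomial ω (P j) u) = 0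

/-- The statement that `z` consists of the coordinates of the images of `1` under
the blocks of `T g T⁻¹`. -/
def IsCoordsOf (g : Matrix (n × ι) (n × ι) R) (z : (n × n) × ι → R) : Prop :=
  ∀ v : (n × n) × ι, (T.det : R) * z v =
    ∑ i, (blockScalar n (T.map (Int.cast : ℤ → R)) * g *
      blockScalar n (T.adjugate.map (Int.cast : ℤ → R))) (v.1.1, v.2) (v.1.2, i) *
        (ω.repr 1 i : R)

theorem Matrix.map_intCast_map {R' : Type*} [CommRing R'] (f : R →+* R') (T : Matrix ι ι ℤ) :
    (T.map (Int.cast : ℤ → R)).map f = T.map (Int.cast : ℤ → R') := by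
  ext i j
  simp

theorem det_map_intCast (T : Matrix ι ι ℤ) : (T.map (Int.cast : ℤ → R)).det = (T.det : R) :=
  ((Int.castRingHom R).map_det T).symm

theorem adjugate_map_intCast (T : Matrix ι ι ℤ) :
    T.adjugate.map (Int.cast : ℤ → R) = (T.map (Int.cast : ℤ → R)).adjugate :=
  (Int.castRingHom R).map_adjugate T

/-- The variables for a block matrix `g` and coordinates `z`. -/
abbrev BlockVar (n ι : Type*) := ((n × ι) × (n × ι)) ⊕ ((n × n) × ι)

/-- The generic matrix `g`. -/
noncomputable def varMatrix (n ι : Type*) :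
    Matrix (n × ι) (n × ι) (MvPolynomial (BlockVar n ι) ℤ) :=
  Matrix.of fun x y => MvPolynomial.X (Sum.inl (x, y))

/-- The generic coordinates `z`. -/
noncomputable def varCoords (n ι : Type*) (v : (n × n) × ι) : MvPolynomial (BlockVar n ι) ℤ :=
  MvPolynomial.X (Sum.inr v)

open MvPolynomial in
/-- The equations defining `IsBlockSolution`. -/
noncomputable def blockEquations {l : ℕ} (P : Fin l → MvPolynomial (n × n) O) :
    ((n × ι) × (n × ι)) ⊕ (Fin l × ι) → MvPolynomial (BlockVar n ι) ℤ :=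
  Sum.elim
    (fun x => (blockScalar n (T.map Int.cast) * varMatrix n ι -
      genericBlock ω (varCoords n ι) * blockScalar n (T.map Int.cast) :
        Matrix (n × ι) (n × ι) (MvPolynomial (BlockVar n ι) ℤ)) x.1 x.2)
    fun y => rename Sum.inr (coordPolynomial ω (P y.1) y.2)

open MvPolynomial in
/-- The equations defining `IsCoordsOf`, together with those of `Q`. -/
noncomputable def coordEquations {m : ℕ} (Q : Fin m → MvPolynomial ((n × ι) × (n × ι)) ℤ) :
    Fin m ⊕ ((n × n) × ι) → MvPolynomial (BlockVar n ι) ℤ :=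
  Sum.elim (fun i => rename Sum.inl (Q i)) fun v => (T.det : MvPolynomial (BlockVar n ι) ℤ) *
    varCoords n ι v - ∑ i, (blockScalar n (T.map Int.cast) * varMatrix n ι *
      blockScalar n (T.adjugate.map Int.cast) :
        Matrix (n × ι) (n × ι) (MvPolynomial (BlockVar n ι) ℤ)) (v.1.1, v.2) (v.1.2, i) *
        (ω.repr 1 i : MvPolynomial (BlockVar n ι) ℤ)

/-- The point given by a matrix and coordinates. -/
def blockPoint (g : Matrix (n × ι) (n × ι) R) (z : (n × n) × ι → R) : BlockVar n ι → R :=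
  Sum.elim (fun y => g y.1 y.2) z

open MvPolynomial in
theorem varMatrix_map (g : Matrix (n × ι) (n × ι) R) (z : (n × n) × ι → R) :
    (varMatrix n ι).map (aeval (blockPoint g z) : _ →ₐ[ℤ] R).toRingHom = g := by
  ext a c
  exact aeval_X _ _

open MvPolynomial in
theorem comp_varCoords (g : Matrix (n × ι) (n × ι) R) (z : (n × n) × ι → R) :
    (aeval (blockPoint g z) : _ →ₐ[ℤ] R).toRingHom ∘ varCoords n ι = z := by
  ext v
  exact aeval_X _ _

open MvPolynomial in
theorem aeval_blockEquations {l : ℕ} (P : Fin l → MvPolynomial (n × n) O)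
    (g : Matrix (n × ι) (n × ι) R) (z : (n × n) × ι → R) :
    (∀ i, aeval (blockPoint g z) (blockEquations ω T P i) = 0) ↔ IsBlockSolution ω T P g z := by
  have h := congrArg₂ (fun A w => blockScalar n (T.map (Int.cast : ℤ → R)) * A -
    genericBlock ω w * blockScalar n (T.map (Int.cast : ℤ → R)))
    (varMatrix_map g z) (comp_varCoords g z)
  rw [← Matrix.map_intCast_map (aeval (blockPoint g z) : _ →ₐ[ℤ] R).toRingHom,
    ← blockScalar_map, ← genericBlock_map, ← Matrix.map_mul, ← Matrix.map_mul,
    ← Matrix.map_sub _ (map_sub _)] at h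
  rw [Sum.forall, IsBlockSolution, ← sub_eq_zero (b := genericBlock ω z * _),
    ← Matrix.map_intCast_map (aeval (blockPoint g z) : _ →ₐ[ℤ] R).toRingHom, ← blockScalar_map, ← h,
    ← Matrix.ext_iff, Prod.forall]
  refine and_congr Iff.rfl (Prod.forall.trans (forall₂_congr fun i u => ?_))
  rw [blockEquations, Sum.elim_inr, aeval_rename]
  rfl

open MvPolynomial in
theorem aeval_coordEquations {m : ℕ} (Q : Fin m → MvPolynomial ((n × ι) × (n × ι)) ℤ)
    (g : Matrix (n × ι) (n × ι) R) (z : (n × n) × ι → R) :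
    (∀ i, aeval (blockPoint g z) (coordEquations ω T Q i) = 0) ↔
      (∀ i, aeval (fun x => g x.1 x.2) (Q i) = 0) ∧ IsCoordsOf ω T g z := by
  rw [Sum.forall]
  refine and_congr (forall_congr' fun i => ?_) (forall_congr' fun v => ?_)
  · rw [coordEquations, Sum.elim_inl, aeval_rename]
    rfl
  · have h := congrArg (fun A => blockScalar n (T.map (Int.cast : ℤ → R)) * A *
      blockScalar n (T.adjugate.map (Int.cast : ℤ → R))) (varMatrix_map g z)
    rw [← Matrix.map_intCast_map (aeval (blockPoint g z) : _ →ₐ[ℤ] R).toRingHom,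
      ← Matrix.map_intCast_map (aeval (blockPoint g z) : _ →ₐ[ℤ] R).toRingHom,
      ← blockScalar_map, ← blockScalar_map, ← Matrix.map_mul, ← Matrix.map_mul] at h
    rw [← Matrix.map_intCast_map (aeval (blockPoint g z) : _ →ₐ[ℤ] R).toRingHom,
      ← Matrix.map_intCast_map (aeval (blockPoint g z) : _ →ₐ[ℤ] R).toRingHom,
      ← blockScalar_map, ← blockScalar_map, ← h, coordEquations, Sum.elim_inr, map_sub,
      sub_eq_zero, map_mul, map_intCast, map_sum, varCoords, aeval_X]
    simp only [map_mul, map_intCast]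
    rfl

open MvPolynomial in
theorem aeval_det_varMatrix (g : Matrix (n × ι) (n × ι) R) (z : (n × n) × ι → R) :
    aeval (blockPoint g z) (varMatrix n ι).det = g.det := by
  conv_rhs => rw [← varMatrix_map g z]
  exact RingHom.map_det (aeval (blockPoint g z) : _ →ₐ[ℤ] R).toRingHom _

open MvPolynomial in
-- Keeping `z` as a variable avoids an existential quantifier, so both sides are polynomial systems
-- and the Nullstellensatz applies directly, with $\det g$ as the polynomial to stay away from.
theorem exists_ne_zero_forall_isBlockSolution_iff {K : Type*} [Field K] [IsAlgClosed K] [CharZero K]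
    {l m : ℕ} (P : Fin l → MvPolynomial (n × n) O)
    (Q : Fin m → MvPolynomial ((n × ι) × (n × ι)) ℤ)
    (H : ∀ (g : Matrix (n × ι) (n × ι) K) (z : (n × n) × ι → K), g.det ≠ 0 →
      (IsBlockSolution ω T P g z ↔
        (∀ i, aeval (fun x => g x.1 x.2) (Q i) = 0) ∧ IsCoordsOf ω T g z)) :
    ∃ D : ℤ, D ≠ 0 ∧ ∀ (κ : Type*) [CommRing κ] [IsDomain κ], (D : κ) ≠ 0 →
      ∀ (g : Matrix (n × ι) (n × ι) κ) (z : (n × n) × ι → κ), g.det ≠ 0 →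
      (IsBlockSolution ω T P g z ↔
        (∀ i, aeval (fun x => g x.1 x.2) (Q i) = 0) ∧ IsCoordsOf ω T g z) := by
  obtain ⟨D, hD, h⟩ := exists_ne_zero_forall_aeval_iff (K := K) (blockEquations ω T P)
    (coordEquations ω T Q) (varMatrix n ι).det fun x hx => by
      have e : x = blockPoint (Matrix.of fun a c => x (Sum.inl (a, c))) fun v => x (Sum.inr v) := by
        ext (v | v) <;> rfl
      rw [e] at hx ⊢
      rw [aeval_det_varMatrix] at hx
      rw [aeval_blockEquations, aeval_coordEquations]
      exact H _ _ hx
  refine ⟨D, hD, fun κ _ _ hκ g z hg => ?_⟩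
  rw [← aeval_blockEquations, ← aeval_coordEquations]
  exact h κ (by simpa using hκ) _ (by rwa [aeval_det_varMatrix])

end Spread

/-! ### Comparison of the two systems over K -/

section Coords

variable {n ι O R S : Type*} [Fintype n] [DecidableEq n] [Fintype ι] [DecidableEq ι] [CommRing O]
  [CommRing R] [CommRing S] [Algebra R S]

theorem isCoordsOf_of_eq (ω : Module.Basis ι ℤ O) (β : Module.Basis ι R S) (j : O →+* S)
    (hj : ∀ u, j (ω u) = β u) (T : Matrix ι ι ℤ) {g : Matrix (n × ι) (n × ι) R}
    {z : (n × n) × ι → R} (h : blockScalar n (T.map (Int.cast : ℤ → R)) * g =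
      genericBlock ω z * blockScalar n (T.map (Int.cast : ℤ → R))) : IsCoordsOf ω T g z := by
  rintro ⟨⟨s, t⟩, u⟩
  rw [h, mul_assoc, adjugate_map_intCast, blockScalar_mul_adjugate, det_map_intCast, mul_smul_comm,
    mul_one]
  simp only [Matrix.smul_apply, smul_eq_mul, mul_assoc]
  rw [← Finset.mul_sum, sum_genericBlock_mul_repr_one ω β j hj]

theorem blockRegular_baseChange (ω : Module.Basis ι ℤ O) (β : Module.Basis ι R S) (j : O →+* S)
    (hj : ∀ u, j (ω u) = β u) (A : Matrix n n O) :
    blockRegular β (A.map j) = (blockRegular ω A).map (Int.cast : ℤ → R) := by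
  ext x y
  simp [blockRegular, leftMulMatrix_baseChange ω β j hj]

end Coords

open MvPolynomial in
theorem isBlockSolution_iff_of_isRestrictionOfScalars {k : Type*} [Field k] [NumberField k]
    {K : Type*} [Field K] [CharZero K]
    {n ι : Type*} [Fintype n] [DecidableEq n] [Fintype ι] [DecidableEq ι] (ω : Module.Basis ι ℤ (𝓞 k))
    (b : Module.Basis ι ℚ k) {T : Matrix ι ι ℤ} {c : ℚ} (hdet : T.det ≠ 0)
    (hT : T.map (Int.cast : ℤ → ℚ) = c • (rationalBasis ω).toMatrix b)
    {G : Subgroup (GL (n × ι) K)} {l : ℕ} {P : Fin l → MvPolynomial (n × n) k}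
    (hG : ∀ g : GL (n × ι) K, g ∈ G ↔ ∃ z : Matrix n n (K ⊗[ℚ] k),
        (g : Matrix (n × ι) (n × ι) K) = blockRegular (Algebra.TensorProduct.basis K b) z ∧
        ∀ j, MvPolynomial.eval₂
          (Algebra.TensorProduct.includeRight : k →ₐ[ℚ] K ⊗[ℚ] k).toRingHom
          (fun x => z x.1 x.2) (P j) = 0)
    {d : 𝓞 k} (hd : d ≠ 0) {P' : Fin l → MvPolynomial (n × n) (𝓞 k)}
    (hP' : ∀ i, map (algebraMap (𝓞 k) k) (P' i) = C (algebraMap (𝓞 k) k d) * P i)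
    (g : GL (n × ι) K) (z : (n × n) × ι → K) :
    IsBlockSolution ω T P' (g : Matrix (n × ι) (n × ι) K) z ↔
      g ∈ G ∧ IsCoordsOf ω T (g : Matrix (n × ι) (n × ι) K) z := by
  let W := Algebra.TensorProduct.basis K (rationalBasis ω)
  let B := Algebra.TensorProduct.basis K b
  let inc : k →+* K ⊗[ℚ] k := (Algebra.TensorProduct.includeRight : k →ₐ[ℚ] K ⊗[ℚ] k).toRingHom
  let j : 𝓞 k →+* K ⊗[ℚ] k := inc.comp (algebraMap (𝓞 k) k)
  have hj : ∀ u, j (ω u) = W u := fun u => by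
    rw [Algebra.TensorProduct.basis_apply, rationalBasis_apply]
    rfl
  have hdetK : (T.map (Int.cast : ℤ → K)).det ≠ 0 := by
    rw [det_map_intCast]
    exact Int.cast_ne_zero.2 hdet
  have hblock (z : (n × n) × ι → K) :
      blockScalar n (T.map (Int.cast : ℤ → K)) * (g : Matrix (n × ι) (n × ι) K) =
        genericBlock ω z * blockScalar n (T.map (Int.cast : ℤ → K)) ↔
      (g : Matrix (n × ι) (n × ι) K) = blockRegular B (ofCoords W z) := by
    rw [← blockRegular_ofCoords ω W j hj,
      ← blockScalar_mul_blockRegular (map_mul_leftMulMatrix_tensor hT)]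
    exact ⟨blockScalar_mul_left_cancel hdetK, congrArg _⟩
  have heq (z : (n × n) × ι → K) : (∀ j u, aeval z (coordPolynomial ω (P' j) u) = 0) ↔
      ∀ j, eval₂ inc (fun x => ofCoords W z x.1 x.2) (P j) = 0 := by
    -- The integral equation is `P` times the constant `d`, which acts on $K\otimes k$ as a unit.
    refine forall_congr' fun i => ?_
    rw [← eval₂_ofCoords_eq_zero_iff ω W j hj, ← eval₂_map, hP', eval₂_mul, eval₂_C]
    refine IsUnit.mul_right_eq_zero (IsUnit.map inc (isUnit_iff_ne_zero.2 ?_))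
    simpa using hd
  rw [hG, IsBlockSolution, hblock, heq]
  constructor
  · exact fun h => ⟨⟨_, h⟩, isCoordsOf_of_eq ω W j hj T ((hblock z).2 h.1)⟩
  · rintro ⟨⟨Z, h⟩, hz⟩
    obtain ⟨z', rfl⟩ := exists_ofCoords W Z
    -- Both are coordinate vectors of the same `g`, and these are unique because $\det T\ne0$.
    have : z = z' := by
      have hz' := isCoordsOf_of_eq ω W j hj T ((hblock z').2 h.1)
      ext v
      exact mul_left_cancel₀ (Int.cast_ne_zero.2 hdet) ((hz v).trans (hz' v).symm)
    exact this ▸ h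

/-! ### Reductions of a linear algebraic group are subgroups -/

open MvPolynomial in
theorem aeval_det_varMatrix_comp {A R σ n : Type*} [CommRing A] [CommRing R] [Algebra A R] [Fintype n]
    [DecidableEq n] (x : σ → R) (f : n × n → σ) :
    aeval x ((Matrix.of fun s t => (X (f (s, t)) : MvPolynomial σ A)).det) =
      (Matrix.of fun s t => x (f (s, t))).det := by
  rw [AlgHom.map_det]
  congr 1
  ext s t
  exact aeval_X _ _

theorem det_glEntries_ne_zero {n R : Type*} [Fintype n] [DecidableEq n] [CommRing R] [Nontrivial R]
    (g : GL n R) : (Matrix.of fun s t => glEntries g (s, t)).det ≠ 0 :=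
  ((Matrix.isUnit_iff_isUnit_det _).1 g.isUnit).ne_zero

open MvPolynomial in
theorem aeval_glEntries_one (A : Type*) {R n : Type*} [CommRing A] [CommRing R] [Algebra A R]
    [Fintype n] [DecidableEq n] (P : MvPolynomial (n × n) A) :
    aeval (glEntries (1 : GL n R)) P = algebraMap A R (aeval (glEntries (1 : GL n A)) P) := by
  rw [← aeval_algebraMap_apply]
  congr 2
  ext x
  by_cases h : x.1 = x.2 <;> simp [glEntries, h]

open MvPolynomial in
/-- The reductions of a linear algebraic group are subgroups. -/
theorem exists_subgroup_of_isCutOutBy {A K n : Type*} [CommRing A] [IsDomain A] [Field K]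
    [IsAlgClosed K] [Algebra A K] [FaithfulSMul A K] [Fintype n] [DecidableEq n]
    (H : Subgroup (GL n K)) {l : ℕ} (P : Fin l → MvPolynomial (n × n) A)
    (hP : ∀ g : GL n K, g ∈ H ↔ ∀ i, aeval (glEntries g) (P i) = 0) :
    ∃ a : A, a ≠ 0 ∧ ∀ (κ : Type*) [CommRing κ] [IsDomain κ] [Finite κ] [Algebra A κ],
      algebraMap A κ a ≠ 0 → ∃ Hκ : Subgroup (GL n κ),
        ∀ g, g ∈ Hκ ↔ ∀ i, aeval (glEntries g) (P i) = 0 := by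
  let σ := (n × n) ⊕ (n × n)
  let mulVar : n × n → MvPolynomial σ A := fun x =>
    ∑ t, X (Sum.inl (x.1, t)) * X (Sum.inr (t, x.2))
  obtain ⟨a, ha, h⟩ := exists_ne_zero_forall_forall_aeval_eq_zero (K := K)
    -- In the variables of a pair of matrices: if both satisfy `P` and both determinants are
    -- nonzero, the product satisfies `P`.
    (Sum.elim (fun i => rename Sum.inl (P i)) fun i => rename (Sum.inr : _ → σ) (P i))
    ((Matrix.of fun s t => (X (Sum.inl (s, t)) : MvPolynomial σ A)).det *
      (Matrix.of fun s t => (X (Sum.inr (s, t)) : MvPolynomial σ A)).det)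
    (fun i => bind₁ mulVar (P i)) (by
      intro x hx hdet i
      rw [map_mul, aeval_det_varMatrix_comp, aeval_det_varMatrix_comp] at hdet
      let g := Matrix.GeneralLinearGroup.mkOfDetNeZero _ (left_ne_zero_of_mul hdet)
      let g' := Matrix.GeneralLinearGroup.mkOfDetNeZero _ (right_ne_zero_of_mul hdet)
      have hg : g ∈ H := (hP g).2 fun i => by
        have := hx (Sum.inl i)
        rw [Sum.elim_inl, aeval_rename] at this
        exact this
      have hg' : g' ∈ H := (hP g').2 fun i => by
        have := hx (Sum.inr i)
        rw [Sum.elim_inr, aeval_rename] at this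
        exact this
      have := (hP _).1 (H.mul_mem hg hg') i
      rw [aeval_bind₁]
      convert this using 3
      ext y
      simp only [mulVar, map_sum, map_mul, aeval_X]
      rfl)
  refine ⟨a, ha, fun κ _ _ _ _ hκ => ?_⟩
  have hmul (g g' : GL n κ) (hg : ∀ i, aeval (glEntries g) (P i) = 0)
      (hg' : ∀ i, aeval (glEntries g') (P i) = 0) (i) : aeval (glEntries (g * g')) (P i) = 0 := by
    have := h κ hκ (Sum.elim (glEntries g) (glEntries g')) ?_ ?_ i
    · rw [aeval_bind₁] at this
      convert this using 3
      ext x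
      simp [mulVar, glEntries, Matrix.mul_apply]
    · rintro (i | i)
      · rw [Sum.elim_inl, aeval_rename, Sum.elim_comp_inl, hg]
      · rw [Sum.elim_inr, aeval_rename, Sum.elim_comp_inr, hg']
    · rw [map_mul, aeval_det_varMatrix_comp, aeval_det_varMatrix_comp]
      exact mul_ne_zero (det_glEntries_ne_zero g) (det_glEntries_ne_zero g')
  -- The identity already has entries in `A`, so its equations hold in `A` and no further prime is
  -- lost.
  have hone (i) : aeval (glEntries (1 : GL n A)) (P i) = 0 := by
    apply FaithfulSMul.algebraMap_injective A K
    rw [map_zero, ← aeval_glEntries_one]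
    exact (hP 1).1 H.one_mem i
  let M : Submonoid (GL n κ) :=
    { carrier := {g | ∀ i, aeval (glEntries g) (P i) = 0}
      mul_mem' := fun {g g'} hg hg' => hmul g g' hg hg'
      one_mem' := fun i => by rw [aeval_glEntries_one A, hone, map_zero] }
  refine ⟨{ M with inv_mem' := fun {g} hg => ?_ }, fun g => Iff.rfl⟩
  -- In a finite group inverses are powers, so closure under products suffices.
  have : g⁻¹ ∈ Submonoid.powers g :=
    (isOfFinOrder_of_finite g).mem_powers_iff_mem_zpowers.2 (Subgroup.inv_mem _ (Subgroup.mem_zpowers g))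
  exact (Submonoid.powers_le (P := M)).2 hg this

/-- A unit of a finite monoid has finite order, so some positive power of `x` is $1$. This keeps the
inverse of a block matrix inside the image of the regular representation. -/
theorem isUnit_of_isUnit_map {M N : Type*} [Monoid M] [Monoid N] [Finite N] (f : M →* N)
    (hf : Function.Injective f) {x : M} (h : IsUnit (f x)) : IsUnit x := by
  obtain ⟨u, hu⟩ := h
  obtain ⟨m, hm, h1⟩ := isOfFinOrder_iff_pow_eq_one.1
    (hf.isOfFinOrder_iff.1 (hu ▸ Units.isOfFinOrder_val.2 (isOfFinOrder_of_finite u)))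
  exact .of_pow_eq_one h1 hm.ne'

theorem PrimeAbove.algebraMap_ne_zero {k : Type*} [Field k] [NumberField k] {p : ℕ} (hp : p.Prime)
    (𝔭 : PrimeAbove k p) {a : 𝓞 k} {N : ℤ} (ha : a ∣ N) (hN : ¬ (p : ℤ) ∣ N) :
    algebraMap (𝓞 k) (𝓞 k ⧸ 𝔭.1) a ≠ 0 := by
  intro h
  obtain ⟨c, hc⟩ := ha
  refine hN ((𝔭.intCast_mem_iff hp N).1 ?_)
  rw [hc]
  exact 𝔭.1.mul_mem_right _ (Ideal.Quotient.eq_zero_iff_mem.1 h)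

/-! ### Matrix groups over the product of the residue rings -/

section Residue

variable {k : Type*} [Field k] [NumberField k] {p : ℕ}

theorem ResidueProd.ext_proj {x y : ResidueProd k p}
    (h : ∀ 𝔭, ResidueProd.proj 𝔭 x = ResidueProd.proj 𝔭 y) : x = y :=
  funext h

/-- The invertible matrices over `∏ 𝓞 / 𝔭` with components in given subgroups. -/
noncomputable def residueSubgroup {n : Type*} [Fintype n] [DecidableEq n]
    (Hq : ∀ 𝔭 : PrimeAbove k p, Subgroup (GL n (𝓞 k ⧸ 𝔭.1))) :
    Subgroup (GL n (ResidueProd k p)) :=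
  ⨅ 𝔭, (Hq 𝔭).comap (Matrix.GeneralLinearGroup.map (ResidueProd.proj 𝔭))

theorem mem_residueSubgroup {n : Type*} [Fintype n] [DecidableEq n]
    (Hq : ∀ 𝔭 : PrimeAbove k p, Subgroup (GL n (𝓞 k ⧸ 𝔭.1))) (Z : GL n (ResidueProd k p)) :
    Z ∈ residueSubgroup Hq ↔
      ∀ 𝔭, Matrix.GeneralLinearGroup.map (ResidueProd.proj 𝔭) Z ∈ Hq 𝔭 := by
  simp only [residueSubgroup, Subgroup.mem_iInf, Subgroup.mem_comap]

/-- A group of matrices over `∏ 𝓞 / 𝔭` decomposes as a product. -/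
theorem exists_residueSubgroup_mulEquiv {n : Type*} [Fintype n] [DecidableEq n]
    (Hq : ∀ 𝔭 : PrimeAbove k p, Subgroup (GL n (𝓞 k ⧸ 𝔭.1))) :
    ∃ e : residueSubgroup Hq ≃* ∀ 𝔭, Hq 𝔭, ∀ Z 𝔭 s t,
      (e Z 𝔭 : GL n (𝓞 k ⧸ 𝔭.1)) s t =
        ResidueProd.proj 𝔭 ((Z : GL n (ResidueProd k p)) s t) := by
  let f : residueSubgroup Hq →* ∀ 𝔭, Hq 𝔭 := MonoidHom.pi fun 𝔭 =>
    ((Matrix.GeneralLinearGroup.map (ResidueProd.proj 𝔭)).comp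
      (residueSubgroup Hq).subtype).codRestrict (Hq 𝔭)
      fun Z => (mem_residueSubgroup Hq Z.1).1 Z.2 𝔭
  have hf : ∀ Z 𝔭 s t, (f Z 𝔭 : GL n (𝓞 k ⧸ 𝔭.1)) s t =
      ResidueProd.proj 𝔭 ((Z : GL n (ResidueProd k p)) s t) := fun Z 𝔭 s t => rfl
  refine ⟨MulEquiv.ofBijective f ⟨fun Z Z' h => ?_, fun h => ?_⟩, hf⟩
  · refine Subtype.ext (Units.ext (Matrix.ext fun s t => ResidueProd.ext_proj fun 𝔭 => ?_))
    rw [← hf, h, hf]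
  · let M : Matrix n n (ResidueProd k p) := Matrix.of fun s t 𝔭 => (h 𝔭 : GL n (𝓞 k ⧸ 𝔭.1)) s t
    let M' : Matrix n n (ResidueProd k p) :=
      Matrix.of fun s t 𝔭 => ((h 𝔭)⁻¹ : GL n (𝓞 k ⧸ 𝔭.1)) s t
    have hM (𝔭) : M.map (ResidueProd.proj 𝔭) = (h 𝔭 : GL n (𝓞 k ⧸ 𝔭.1)) := rfl
    have hM' (𝔭) : M'.map (ResidueProd.proj 𝔭) = ((h 𝔭)⁻¹ : GL n (𝓞 k ⧸ 𝔭.1)) := rfl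
    have hext {A B : Matrix n n (ResidueProd k p)}
        (h : ∀ 𝔭, A.map (ResidueProd.proj 𝔭) = B.map (ResidueProd.proj 𝔭)) : A = B :=
      Matrix.ext fun s t => ResidueProd.ext_proj fun 𝔭 => congrFun (congrFun (h 𝔭) s) t
    let Z : GL n (ResidueProd k p) := ⟨M, M', hext fun 𝔭 => by
        rw [Matrix.map_mul, hM, hM', Matrix.map_one _ (map_zero _) (map_one _)]
        exact Units.mul_inv _, hext fun 𝔭 => by
        rw [Matrix.map_mul, hM, hM', Matrix.map_one _ (map_zero _) (map_one _)]
        exact Units.inv_mul _⟩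
    have hZ (𝔭) : Matrix.GeneralLinearGroup.map (ResidueProd.proj 𝔭) Z =
        (h 𝔭 : GL n (𝓞 k ⧸ 𝔭.1)) := Units.ext (hM 𝔭)
    refine ⟨⟨Z, (mem_residueSubgroup Hq Z).2 fun 𝔭 => ?_⟩, ?_⟩
    · rw [hZ]
      exact (h 𝔭).2
    · funext 𝔭
      exact Subtype.ext (hZ 𝔭)

open MvPolynomial in
theorem eval₂_diag_eq_zero_iff {ν : Type*} (P : MvPolynomial ν (𝓞 k)) (x : ν → ResidueProd k p) :
    eval₂ (ResidueProd.diag k p) x P = 0 ↔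
      ∀ 𝔭 : PrimeAbove k p, aeval (fun v => ResidueProd.proj 𝔭 (x v)) P = 0 := by
  have h (𝔭 : PrimeAbove k p) : ResidueProd.proj 𝔭 (eval₂ (ResidueProd.diag k p) x P) =
      aeval (fun v => ResidueProd.proj 𝔭 (x v)) P := by
    rw [hom_eval₂]
    rfl
  refine ⟨fun h0 𝔭 => by rw [← h, h0, map_zero], fun h0 => ResidueProd.ext_proj fun 𝔭 => ?_⟩
  rw [h, h0, map_zero]

end Residue

/-! ### Conjugating the regular representation by T -/

section Conj

variable {n ι R S : Type*} [Fintype n] [DecidableEq n] [Fintype ι] [DecidableEq ι] [CommRing R]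
  [CommRing S] [Algebra R S]

/-- The homomorphism `Z ↦ T⁻¹ ρ(Z) T`. -/
noncomputable def conjBlockRegular (β : Module.Basis ι R S) (t : GL ι R) :
    GL n S →* GL (n × ι) R :=
  (MulAut.conj (Units.map (blockScalar n).toMonoidHom t)⁻¹).toMonoidHom.comp
    (Units.map (blockRegularHom n β).toMonoidHom)

theorem conjBlockRegular_eq_iff (β : Module.Basis ι R S) (t : GL ι R) (Z : GL n S)
    (g : GL (n × ι) R) : conjBlockRegular β t Z = g ↔
      blockScalar n (t : Matrix ι ι R) * (g : Matrix (n × ι) (n × ι) R) =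
        blockRegular β (Z : Matrix n n S) * blockScalar n (t : Matrix ι ι R) := by
  rw [conjBlockRegular, MonoidHom.comp_apply, MulEquiv.coe_toMonoidHom, MulAut.conj_apply, inv_inv,
    mul_assoc, inv_mul_eq_iff_eq_mul, Units.ext_iff, eq_comm]
  rfl

theorem conjBlockRegular_injective (β : Module.Basis ι R S) (t : GL ι R) :
    Function.Injective (conjBlockRegular (n := n) β t) := by
  intro Z Z' h
  have h1 := (conjBlockRegular_eq_iff β t Z _).1 h
  rw [(conjBlockRegular_eq_iff β t Z' _).1 rfl] at h1
  have ht : IsUnit (blockScalar n (t : Matrix ι ι R)) := t.isUnit.map _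
  exact Units.ext (blockRegularHom_injective β (ht.mul_right_cancel h1).symm)

end Conj

/-! ### The points of G modulo p -/

section ModP

variable {k : Type*} [Field k] [NumberField k] {n ι : Type*} [Fintype n] [DecidableEq n] [Fintype ι]
  [DecidableEq ι] {p : ℕ}

open MvPolynomial in
-- Over $\mathbb F_p$ block solutions come from matrices over $\prod\mathcal O/\mathfrak p$, because
-- `β` is a basis of this product. The equivalence `hPQ` then trades the block equations for those
-- of `Q`.
theorem map_conjBlockRegular_eq (hp : p.Prime) (ω : Module.Basis ι ℤ (𝓞 k))
    [Algebra (ZMod p) (ResidueProd k p)] (β : Module.Basis ι (ZMod p) (ResidueProd k p))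
    (hβ : ∀ u, ResidueProd.diag k p (ω u) = β u) (T : Matrix ι ι ℤ) (t : GL ι (ZMod p))
    (ht : (t : Matrix ι ι (ZMod p)) = T.map (Int.cast : ℤ → ZMod p))
    {l m : ℕ} {P : Fin l → MvPolynomial (n × n) (𝓞 k)}
    {Q : Fin m → MvPolynomial ((n × ι) × (n × ι)) ℤ}
    (hPQ : ∀ (g : Matrix (n × ι) (n × ι) (ZMod p)) (z : (n × n) × ι → ZMod p), g.det ≠ 0 →
      (IsBlockSolution ω T P g z ↔
        (∀ i, aeval (fun x => g x.1 x.2) (Q i) = 0) ∧ IsCoordsOf ω T g z))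
    (Hq : ∀ 𝔭 : PrimeAbove k p, Subgroup (GL n (𝓞 k ⧸ 𝔭.1)))
    (hH : ∀ 𝔭 g, g ∈ Hq 𝔭 ↔ ∀ i, aeval (glEntries g) (P i) = 0) (g : GL (n × ι) (ZMod p)) :
    g ∈ (residueSubgroup Hq).map (conjBlockRegular β t) ↔
      ∀ i, aeval (glEntries g) (Q i) = 0 := by
  have : Fact p.Prime := ⟨hp⟩
  have hg : (g : Matrix (n × ι) (n × ι) (ZMod p)).det ≠ 0 := det_glEntries_ne_zero g
  have hmem (Z : GL n (ResidueProd k p)) : Z ∈ residueSubgroup Hq ↔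
      ∀ i, eval₂ (ResidueProd.diag k p) (fun x => (Z : Matrix n n (ResidueProd k p)) x.1 x.2) (P i) = 0 := by
    simp only [mem_residueSubgroup, hH, eval₂_diag_eq_zero_iff]
    exact forall_comm
  rw [Subgroup.mem_map]
  constructor
  · rintro ⟨Z, hZ, hZg⟩
    rw [conjBlockRegular_eq_iff, ht] at hZg
    obtain ⟨z, hz⟩ := exists_ofCoords β (Z : Matrix n n (ResidueProd k p))
    rw [hmem, ← hz] at hZ
    rw [← hz, blockRegular_ofCoords ω β _ hβ] at hZg
    exact ((hPQ _ z hg).1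
      ⟨hZg, fun j => (eval₂_ofCoords_eq_zero_iff ω β _ hβ (P j) z).1 (hZ j)⟩).1
  · intro hQ
    have hdet : (T.det : ZMod p) ≠ 0 := by
      rw [← det_map_intCast, ← ht]
      exact det_glEntries_ne_zero t
    -- As $\det T$ is invertible modulo $p$, every `g` has a coordinate vector; `hPQ` then shows
    -- that `g` really is the block matrix it describes.
    obtain ⟨z, hz⟩ : ∃ z, IsCoordsOf ω T (g : Matrix (n × ι) (n × ι) (ZMod p)) z :=
      ⟨fun v => (T.det : ZMod p)⁻¹ * _, fun v => mul_inv_cancel_left₀ hdet _⟩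
    obtain ⟨h1, h2⟩ := (hPQ _ z hg).2 ⟨hQ, hz⟩
    rw [← blockRegular_ofCoords ω β _ hβ, ← ht] at h1
    have hunit : IsUnit (blockRegularHom n β (ofCoords β z)) := by
      have ht' : IsUnit (blockScalar n (t : Matrix ι ι (ZMod p))) := t.isUnit.map _
      have := ht'.mul g.isUnit
      rw [h1] at this
      exact ht'.mul_right_iff.1 this
    obtain ⟨Z, hZ⟩ := isUnit_of_isUnit_map (blockRegularHom n β).toMonoidHom
      (blockRegularHom_injective β) hunit
    refine ⟨Z, (hmem Z).2 fun i => ?_, ?_⟩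
    · rw [hZ]
      exact (eval₂_ofCoords_eq_zero_iff ω β _ hβ (P i) z).2 (h2 i)
    · rw [conjBlockRegular_eq_iff, hZ, h1]

theorem reducesTo_blockRegular_iff (hp : p.Prime) (ω : Module.Basis ι ℤ (𝓞 k))
    [Algebra (ZMod p) (ResidueProd k p)] (β : Module.Basis ι (ZMod p) (ResidueProd k p))
    (hβ : ∀ u, ResidueProd.diag k p (ω u) = β u) (b : Module.Basis ι ℚ k) {T : Matrix ι ι ℤ} {c : ℚ}
    (hT : T.map (Int.cast : ℤ → ℚ) = c • (rationalBasis ω).toMatrix b)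
    (t : GL ι (ZMod p)) (ht : (t : Matrix ι ι (ZMod p)) = T.map (Int.cast : ℤ → ZMod p))
    (Z : GL n (ResidueProd k p)) (A : Matrix n n (𝓞 k)) :
    (∀ x y : n × ι, ReducesTo (Int.castRingHom (ZMod p))
      (blockRegular b (A.map (algebraMap (𝓞 k) k)) x y)
      ((conjBlockRegular β t Z : GL (n × ι) (ZMod p)) x y)) ↔
    (Z : Matrix n n (ResidueProd k p)) = A.map (ResidueProd.diag k p) := by
  have : Fact p.Prime := ⟨hp⟩
  have hdet : (T.det : ZMod p) ≠ 0 := by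
    rw [← det_map_intCast, ← ht]
    exact det_glEntries_ne_zero t
  -- This is $\det T\cdot T^{-1}\rho_\omega(A)T=\det T\cdot\rho_b(A)$, so $\det T$ is a denominator
  -- of $\rho_b(A)$ that is prime to $p$.
  let M : Matrix (n × ι) (n × ι) ℤ :=
    blockScalar n T.adjugate * (blockRegular ω A * blockScalar n T)
  have hM {R : Type} [CommRing R] : M.map (Int.cast : ℤ → R) =
      blockScalar n (T.map (Int.cast : ℤ → R)).adjugate *
        ((blockRegular ω A).map (Int.cast : ℤ → R) * blockScalar n (T.map (Int.cast : ℤ → R))) := by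
    rw [← adjugate_map_intCast]
    have := congrArg₂ (· * ·) (blockScalar_map (n := n) (Int.castRingHom R) T.adjugate)
      (congrArg ((blockRegular ω A).map (Int.castRingHom R) * ·)
        (blockScalar_map (n := n) (Int.castRingHom R) T))
    rw [← Matrix.map_mul, ← Matrix.map_mul] at this
    exact this
  have hQ : (T.det : ℚ) • blockRegular b (A.map (algebraMap (𝓞 k) k)) =
      M.map (Int.cast : ℤ → ℚ) := by
    rw [hM, ← blockRegular_baseChange ω (rationalBasis ω) (algebraMap (𝓞 k) k)
      (fun u => (rationalBasis_apply ω u).symm),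
      ← blockScalar_mul_blockRegular (map_mul_leftMulMatrix hT), ← mul_assoc,
      blockScalar_adjugate_mul, det_map_intCast, smul_mul_assoc, one_mul]
  set g := conjBlockRegular β t Z with hg
  have hgZ := (conjBlockRegular_eq_iff β t Z g).1 hg.symm
  have hred (x y) : ReducesTo (Int.castRingHom (ZMod p))
      (blockRegular b (A.map (algebraMap (𝓞 k) k)) x y) (g x y) ↔
      ((T.det : ZMod p) • (g : Matrix (n × ι) (n × ι) (ZMod p))) x y = M.map Int.cast x y := by
    rw [reducesTo_iff (A := ℤ) (a := M x y) (d := T.det) _ hdet, mul_comm]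
    · rfl
    · rw [mul_comm]
      exact congrFun (congrFun hQ x) y
  simp only [hred]
  rw [Matrix.ext_iff, hM, ← ht, ← blockRegular_baseChange ω β _ hβ, ← det_map_intCast, ← ht]
  have ht' : IsUnit (blockScalar n (t : Matrix ι ι (ZMod p))) := t.isUnit.map _
  have hadj : (t : Matrix ι ι (ZMod p)).det • (g : Matrix (n × ι) (n × ι) (ZMod p)) =
      blockScalar n (t : Matrix ι ι (ZMod p)).adjugate *
        (blockRegular β (Z : Matrix n n _) * blockScalar n (t : Matrix ι ι (ZMod p))) := by
    rw [← hgZ, ← mul_assoc, blockScalar_adjugate_mul, smul_mul_assoc, one_mul]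
  rw [hadj]
  refine ⟨fun h => ?_, fun h => by rw [h]⟩
  -- Multiplying by `T` turns its adjugate into the nonzero scalar $\det T$; then `T` on the right
  -- and the injective regular representation are cancelled.
  have h2 := congrArg (blockScalar n (t : Matrix ι ι (ZMod p)) * ·) h
  simp only [← mul_assoc, blockScalar_mul_adjugate, smul_mul_assoc, one_mul] at h2
  have h3 := smul_right_injective _ (det_glEntries_ne_zero t) h2
  exact blockRegularHom_injective β (ht'.mul_right_cancel h3)

end ModP

/-! ### Independence of the equations and conclusion -/

open MvPolynomial in
/-- Two systems defining the same linear algebraic group have the same points modulo almost all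
primes. -/
theorem exists_forall_aeval_glEntries_iff {A K n : Type*} [CommRing A] [IsDomain A] [Field K]
    [IsAlgClosed K] [Algebra A K] [FaithfulSMul A K] [Fintype n] [DecidableEq n]
    {l l' : ℕ} (P : Fin l → MvPolynomial (n × n) A) (P' : Fin l' → MvPolynomial (n × n) A)
    (h : ∀ g : GL n K, (∀ i, aeval (glEntries g) (P i) = 0) ↔
      ∀ i, aeval (glEntries g) (P' i) = 0) :
    ∃ a : A, a ≠ 0 ∧ ∀ (κ : Type*) [CommRing κ] [IsDomain κ] [Algebra A κ], algebraMap A κ a ≠ 0 →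
      ∀ g : GL n κ, (∀ i, aeval (glEntries g) (P i) = 0) ↔
        ∀ i, aeval (glEntries g) (P' i) = 0 := by
  obtain ⟨a, ha, h'⟩ := exists_ne_zero_forall_aeval_iff (K := K) P P'
    ((Matrix.of fun s t => X (id (s, t))).det) fun x hx => by
      rw [aeval_det_varMatrix_comp x id] at hx
      exact h (Matrix.GeneralLinearGroup.mkOfDetNeZero _ hx)
  refine ⟨a, ha, fun κ _ _ _ hκ g => h' κ hκ _ ?_⟩
  rw [aeval_det_varMatrix_comp _ id]
  exact det_glEntries_ne_zero g

theorem mainTheorem10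
    {k : Type*} [Field k] [NumberField k] [IsGalois ℚ k]
    {K : Type*} [Field K] [CharZero K] [IsAlgClosed K] [Algebra k K]
    {n : ℕ} (H : Subgroup (GL (Fin n) K))
    {ι : Type*} [Fintype ι] [DecidableEq ι] (b : Module.Basis ι ℚ k)
    (G : Subgroup (GL (Fin n × ι) K)) (hG : IsRestrictionOfScalars b H G)
    {l : ℕ} (P : Fin l → MvPolynomial (Fin n × Fin n) k) (hP : IsCutOutBy H P)
    {m : ℕ} (Q : Fin m → MvPolynomial ((Fin n × ι) × (Fin n × ι)) ℚ) (hQ : IsCutOutBy G Q) :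
    ∃ E : Finset ℕ, ∀ p : ℕ, p.Prime → p ∉ E →
      ∃ (Gp : Subgroup (GL (Fin n × ι) (ZMod p)))
        (Hq : ∀ 𝔭 : PrimeAbove k p, Subgroup (GL (Fin n) (𝓞 k ⧸ 𝔭.1))),
        (Gp : Set (GL (Fin n × ι) (ZMod p))) = reducedPoints (Int.castRingHom (ZMod p)) Q ∧
        (∀ 𝔭 : PrimeAbove k p, (Hq 𝔭 : Set (GL (Fin n) (𝓞 k ⧸ 𝔭.1))) =
          reducedPoints (Ideal.Quotient.mk 𝔭.1) P) ∧
        ∃ Φ : Gp ≃* (∀ 𝔭 : PrimeAbove k p, Hq 𝔭),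
          ∀ (g : Gp) (A : Matrix (Fin n) (Fin n) (𝓞 k)),
            (∀ (𝔭 : PrimeAbove k p) (s t : Fin n),
              (Φ g 𝔭 : GL (Fin n) (𝓞 k ⧸ 𝔭.1)) s t = Ideal.Quotient.mk 𝔭.1 (A s t)) ↔
            ∀ x y : Fin n × ι, ReducesTo (Int.castRingHom (ZMod p))
              (blockRegular b (A.map (algebraMap (𝓞 k) k)) x y)
              ((g : GL (Fin n × ι) (ZMod p)) x y) := by

  obtain ⟨l₀, P₀, hP₀, hG⟩ := hG
  let ω : Module.Basis ι ℤ (𝓞 k) := (NumberField.RingOfIntegers.basis k).reindex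
    ((NumberField.integralBasis k).indexEquiv b)
  have : FaithfulSMul (𝓞 k) K := (faithfulSMul_iff_algebraMap_injective _ _).2 <| by
    rw [IsScalarTower.algebraMap_eq (𝓞 k) k K]
    exact (algebraMap k K).injective.comp (IsFractionRing.injective _ _)
  obtain ⟨T, c, -, hdet, hT⟩ := exists_integral_toMatrix ω b
  obtain ⟨d₀, hd₀, P₀', hP₀'⟩ := exists_common_denominator (A := 𝓞 k) P₀
  obtain ⟨d₁, hd₁, P', hP'⟩ := exists_common_denominator (A := 𝓞 k) P
  obtain ⟨d₂, hd₂, Q', hQ'⟩ := exists_common_denominator (A := ℤ) Q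
  have hP₀K := isCutOutBy_iff_aeval hP₀ hd₀ hP₀'
  have hPK := isCutOutBy_iff_aeval hP hd₁ hP'
  have hQK := isCutOutBy_iff_aeval hQ hd₂ hQ'
  obtain ⟨D, hD, hspread⟩ := exists_ne_zero_forall_isBlockSolution_iff (K := K) ω T P₀' Q'
    fun g z hg => by
      rw [show g = (Matrix.GeneralLinearGroup.mkOfDetNeZero g hg : Matrix _ _ K) from rfl,
        isBlockSolution_iff_of_isRestrictionOfScalars ω b hdet hT hG hd₀ hP₀', hQK]
      rfl
  obtain ⟨a₁, ha₁, hsub⟩ := exists_subgroup_of_isCutOutBy H P' hPK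
  -- The equations $P_0$ used to define `G` may differ from the given `P`; both cut out `H`, so they
  -- agree modulo almost all primes.
  obtain ⟨a₂, ha₂, heq⟩ := exists_forall_aeval_glEntries_iff (K := K) P' P₀'
    fun g => (hPK g).symm.trans (hP₀K g)
  obtain ⟨N, hN, hdvd⟩ := exists_intCast_dvd (mul_ne_zero (mul_ne_zero ha₁ ha₂) hd₁)
  have hdisc : Algebra.discr ℤ ω ≠ 0 := by
    rw [NumberField.discr_eq_discr]
    exact NumberField.discr_ne_zero k
  -- Excluded primes: `N` controls the subgroup property, the comparison of `P` with $P_0$ and the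
  -- denominators of `P`; `D` the spreading out; $\det T$ the conjugation; `d₂` the denominators of
  -- `Q`; the discriminant the ramification.
  refine ⟨(N * D * T.det * d₂ * Algebra.discr ℤ ω).natAbs.primeFactors, fun p hp hpE => ?_⟩
  have hpN : ¬ (p : ℤ) ∣ N * D * T.det * d₂ * Algebra.discr ℤ ω := fun h => hpE <|
    Nat.mem_primeFactors.2 ⟨hp, Int.natCast_dvd.1 h, Int.natAbs_ne_zero.2 <|
      mul_ne_zero (mul_ne_zero (mul_ne_zero (mul_ne_zero hN hD) hdet) hd₂) hdisc⟩
  have : Fact p.Prime := ⟨hp⟩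
  have hcast : ((N * D * T.det * d₂ * Algebra.discr ℤ ω : ℤ) : ZMod p) ≠ 0 := fun h =>
    hpN ((ZMod.intCast_zmod_eq_zero_iff_dvd _ _).1 h)
  simp only [Int.cast_mul, mul_ne_zero_iff] at hcast
  obtain ⟨⟨⟨⟨hpN', hpD⟩, hpT⟩, hpd⟩, hpdisc⟩ := hcast
  have hpN'' : ¬ (p : ℤ) ∣ N := fun h => hpN' ((ZMod.intCast_zmod_eq_zero_iff_dvd _ _).2 h)
  have hres (𝔭 : PrimeAbove k p) : (algebraMap (𝓞 k) (𝓞 k ⧸ 𝔭.1) a₁ ≠ 0 ∧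
      algebraMap (𝓞 k) (𝓞 k ⧸ 𝔭.1) a₂ ≠ 0) ∧ algebraMap (𝓞 k) (𝓞 k ⧸ 𝔭.1) d₁ ≠ 0 := by
    have := 𝔭.2.1
    have := 𝔭.algebraMap_ne_zero hp hdvd hpN''
    simpa only [map_mul, mul_ne_zero_iff] using this
  have hfin (𝔭 : PrimeAbove k p) : Finite (𝓞 k ⧸ 𝔭.1) :=
    Ideal.finiteQuotientOfFreeOfNeBot _ fun h => by
      have := 𝔭.2.2
      rw [h] at this
      exact hp.ne_zero (by simpa using this)
  have hdom (𝔭 : PrimeAbove k p) : IsDomain (𝓞 k ⧸ 𝔭.1) :=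
    (Ideal.Quotient.isDomain_iff_prime _).2 𝔭.2.1
  choose Hq hHq using fun 𝔭 : PrimeAbove k p => hsub (𝓞 k ⧸ 𝔭.1) (hres 𝔭).1.1
  let _ : Algebra (ZMod p) (ResidueProd k p) := ResidueProd.algebra k hp
  obtain ⟨β, hβ⟩ := ResidueProd.exists_basis ω hp fun h =>
    hpdisc ((ZMod.intCast_zmod_eq_zero_iff_dvd _ _).2 h)
  let t : GL ι (ZMod p) := Matrix.GeneralLinearGroup.mkOfDetNeZero (T.map Int.cast)
    (by rwa [det_map_intCast])
  obtain ⟨e, he⟩ := exists_residueSubgroup_mulEquiv Hq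
  have hinj := conjBlockRegular_injective (n := Fin n) β t
  -- Taking the group modulo $p$ to be an image under a homomorphism makes it a subgroup at once;
  -- that it is the zero set of `Q` is proved afterwards.
  refine ⟨(residueSubgroup Hq).map (conjBlockRegular β t), Hq, ?_, fun 𝔭 => ?_,
    ((residueSubgroup Hq).equivMapOfInjective _ hinj).symm.trans e, fun g A => ?_⟩
  · ext g
    rw [SetLike.mem_coe, map_conjBlockRegular_eq hp ω β (fun u => (hβ u).symm) T t rfl
      (hspread (ZMod p) hpD) Hq fun 𝔭 g => (hHq 𝔭 g).trans (heq _ (hres 𝔭).1.2 g)]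
    exact (mem_reducedPoints_iff (A := ℤ) (κ := ZMod p) (isUnit_iff_ne_zero.2 hpd) hQ' g).symm
  · ext g
    have := 𝔭.isMaximal hp
    let _ := Ideal.Quotient.field 𝔭.1
    rw [SetLike.mem_coe, hHq]
    exact (mem_reducedPoints_iff (A := 𝓞 k) (κ := 𝓞 k ⧸ 𝔭.1)
      (isUnit_iff_ne_zero.2 (hres 𝔭).2) hP' g).symm
  · obtain ⟨Z, rfl⟩ := ((residueSubgroup Hq).equivMapOfInjective _ hinj).surjective g
    rw [MulEquiv.trans_apply, MulEquiv.symm_apply_apply, Subgroup.coe_equivMapOfInjective_apply,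
      reducesTo_blockRegular_iff hp ω β (fun u => (hβ u).symm) b hT t rfl]
    simp only [he]
    exact ⟨fun h => Matrix.ext fun s t => ResidueProd.ext_proj fun 𝔭 => h 𝔭 s t,
      fun h 𝔭 s t => by rw [h]; rfl⟩
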